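/- Let $\mathcal A$ be the mod 2 Steenrod algebra, and let $M$ be a finite-dimensional $\mathbb Z$-graded $\mathcal A$-module, for instance $M=H^*(X;\mathbb F_2)$ for a finite CW spectrum $X$. Let $\cdots\to F_1\to F_0\to\mathbb F_2$ be a graded free $\mathcal A$-resolution of finite type, with ordered homogeneous $\mathcal A$-bases $\{r^*_{s,j}\}_j$ of $F_s$ (finitely many in each degree), and let $\{e_k^*\}$ be an ordered homogeneous $\mathbb F_2$-basis of $M$ in which elements of lower degree come first. Let $\mathcal A$ act diagonally on $M\otimes F_s$, and let $C^s=\mathrm{Hom}_{\mathcal A}(M\otimes_{\mathbb F_2}F_s,\mathbb F_2)$. All Hom complexes are considered in each internal degree separately, where they are finite-dimensional in each cohomological degree $s$. *Curtis tables.* For a complex $X_0\to X_1\to\cdots$ of $\mathbb F_2$-vector spaces with ordered bases $\{x_{s,j}\}_j$, the leading term of an element is its largest basis element with nonzero coefficient. A Curtis table consists of lists $L_s$ of items, each of which is an element $x_{s,j}$ (untagged) or a tag $x_{s,j}\leftarrow x_{s-1,k}$, such that (i) each $x_{s,j}$ appears exactly once in the lists; (ii) an item $x_{s,j}$ or $x_{s,j}\leftarrow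 x_{s-1,k}$ is in $L_s$ if and only if some cycle of $X_s$ has leading term $x_{s,j}$; (iii) if $x_{s,j}\leftarrow x_{s-1,k}$ is a tag, then some element of $X_{s-1}$ with leading term $x_{s-1,k}$ has boundary with leading term $x_{s,j}$. *The spectral sequence.* Filter $C^*$ by $G_nC^s=\{\varphi:\varphi|_{M^{>n}\otimes F_s}=0\}$. The spectral sequence $(E_r,d_r)_{r\ge 0}$ of this filtered complex, $d_r:E_r^n\to E_r^{n-r}$, is the algebraic Atiyah–Hirzebruch spectral sequence (from $E_1=\bigoplus_n \mathrm{Ext}_{\mathcal A}(\mathbb F_2,\mathbb F_2)\otimes (M^n)^*$ on). Label its pages as follows: $E_0$ has the basis of the classes of the $e_k\otimes r_{s,j}$ (defined in the theorem), and $E_{r+1}=H(E_r,d_r)$ has the basis labelled by the untagged items $x$ of the Curtis table of $(E_r,d_r)$, where $x$ denotes the class of a homogeneous $d_r$-cycle with leading term $x$. The tags of the Curtis tables of $(E_r,d_r)$, $r\ge1$, form the table of algebraic Atiyah–Hirzebruch differentials. **Theorem.** The functionals $r_{s,j}$ and $e_k\otimes r_{s,j}$ dual to $r^*_{s,j}$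 and $e^*_k\otimes r^*_{s,j}$ exist and form bases of $\mathrm{Hom}_{\mathcal A}(F_s,\mathbb F_2)$ and of $C^s$; order the latter lexicographically. The complexes $\mathrm{Hom}_{\mathcal A}(F_*,\mathbb F_2)$ and $C^*$ have unique Curtis tables for these bases, labels on the pages as above exist, and for any such labels: 1. For every tag $a\leftarrow b$ in the Curtis table of $\mathrm{Hom}_{\mathcal A}(F_*,\mathbb F_2)$ and every $k$ there is a tag $e_k\otimes a\leftarrow e_k\otimes b$ in the Curtis table of $C^*$; these are exactly the tags of the page $(E_0,d_0)$. 2. The tags of the Curtis table of $C^*$ that are not of the form in 1 are exactly those in the table of algebraic Atiyah–Hirzebruch differentials; a tag of the table of $(E_r,d_r)$ lowers the degree of $e_k$ by $r$. 3. The labels that occur in no tag of 1 or 2 are exactly the untagged items of the Curtis table of $C^*$, and are exactly the labels that survive to every page $E_r$. They correspond to the permanent cycles: if $z_x$ is a cycle of $C^*$ with untagged leading term $x$, then the class of $z_x$ in $E_r$ has leading term $x$ for every $r$, and for any choice of one such cycle for each untagged $x$, the classes of the $z_x$ form a basis of $E_\infty$. -/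

import Mathlib

open scoped TensorProduct

namespace CurtisAHSS

universe u v w

/-! ### The mod 2 Steenrod algebra -/

/-- The relations `Sq⁰ = 1` and the Adem relations
`Sqᵃ Sqᵇ = ∑_j C(b-1-j, a-2j) Sqᵃ⁺ᵇ⁻ʲ Sqʲ` for `0 < a < 2b` (here `j ≤ a/2 < b`, so that no
subtraction is truncated). -/
inductive AdemRel : FreeAlgebra (ZMod 2) ℕ → FreeAlgebra (ZMod 2) ℕ → Prop
  | sq_zero : AdemRel (FreeAlgebra.ι (ZMod 2) 0) 1
  | adem (a b : ℕ) (ha : 0 < a) (hab : a < 2 * b) :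
      AdemRel (FreeAlgebra.ι (ZMod 2) a * FreeAlgebra.ι (ZMod 2) b)
        (∑ j ∈ Finset.range (a / 2 + 1), (Nat.choose (b - 1 - j) (a - 2 * j) : ZMod 2) •
          (FreeAlgebra.ι (ZMod 2) (a + b - j) * FreeAlgebra.ι (ZMod 2) j))

/-- The mod 2 Steenrod algebra: generators `Sqⁱ`, Adem relations. -/
abbrev SteenrodAlgebra : Type := RingQuot AdemRel

/-- The Steenrod square `Sqⁱ`. -/
noncomputable def Sq (i : ℕ) : SteenrodAlgebra :=
  RingQuot.mkAlgHom (ZMod 2) AdemRel (FreeAlgebra.ι (ZMod 2) i)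

/-- The action of `Sqⁱ` on a module over the Steenrod algebra, as an `𝔽₂`-linear map. -/
noncomputable def sqEnd (N : Type*) [AddCommGroup N] [Module (ZMod 2) N]
    [Module SteenrodAlgebra N] [IsScalarTower (ZMod 2) SteenrodAlgebra N] (i : ℕ) :
    N →ₗ[ZMod 2] N :=
  Algebra.lsmul (ZMod 2) (ZMod 2) N (Sq i)

/-- The diagonal action of `Sqⁱ` on `M ⊗ N`, given by the Cartan formula
`Sqⁱ (m ⊗ n) = ∑_{p+q=i} Sqᵖ m ⊗ Sq^q n`. -/
noncomputable def sqTensor (M N : Type*) [AddCommGroup M] [Module (ZMod 2) M]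
    [Module SteenrodAlgebra M] [IsScalarTower (ZMod 2) SteenrodAlgebra M]
    [AddCommGroup N] [Module (ZMod 2) N]
    [Module SteenrodAlgebra N] [IsScalarTower (ZMod 2) SteenrodAlgebra N] (i : ℕ) :
    M ⊗[ZMod 2] N →ₗ[ZMod 2] M ⊗[ZMod 2] N :=
  ∑ p ∈ Finset.HasAntidiagonal.antidiagonal i, TensorProduct.map (sqEnd M p.1) (sqEnd N p.2)

/-- `𝓜` makes `M` a `ℤ`-graded module over the Steenrod algebra, `Sqⁱ` having degree `i`. -/
structure IsGradedModule {M : Type*} [AddCommGroup M] [Module (ZMod 2) M]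
    [Module SteenrodAlgebra M] (𝓜 : ℤ → Submodule (ZMod 2) M) : Prop where
  isInternal : DirectSum.IsInternal 𝓜
  sq_mem : ∀ (i : ℕ) (n : ℤ) (x : M), x ∈ 𝓜 n → Sq i • x ∈ 𝓜 (n + i)

/-- A graded free resolution `⋯ → F₁ → F₀ → 𝔽₂` of `𝔽₂` (placed in degree `0`) over the Steenrod
algebra, of finite type, together with ordered homogeneous bases `r*_{s,j}` of the `F_s`.
The positive-degree squares act trivially on `𝔽₂`, and the squares generate the algebra, so
the linearity of the augmentation says that it kills the image of every `Sqⁱ`, `i > 0`. -/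
structure FreeResolution where
  F : ℕ → Type v
  [addCommGroup : ∀ s, AddCommGroup (F s)]
  [moduleF2 : ∀ s, Module (ZMod 2) (F s)]
  [moduleA : ∀ s, Module SteenrodAlgebra (F s)]
  [tower : ∀ s, IsScalarTower (ZMod 2) SteenrodAlgebra (F s)]
  grading : ∀ s, ℤ → Submodule (ZMod 2) (F s)
  isGraded : ∀ s, IsGradedModule (grading s)
  bd : ∀ s, F (s + 1) →ₗ[SteenrodAlgebra] F s
  bd_mem : ∀ s n x, x ∈ grading (s + 1) n → bd s x ∈ grading s n
  aug : F 0 →ₗ[ZMod 2] ZMod 2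
  aug_sq : ∀ i, 0 < i → ∀ x, aug (Sq i • x) = 0
  aug_degree : ∀ n, n ≠ 0 → ∀ x ∈ grading 0 n, aug x = 0
  aug_surjective : Function.Surjective aug
  exact_zero : Function.Exact (bd 0) aug
  exact_succ : ∀ s, Function.Exact (bd (s + 1)) (bd s)
  J : ℕ → Type w
  [order : ∀ s, LinearOrder (J s)]
  basis : ∀ s, Module.Basis (J s) SteenrodAlgebra (F s)
  deg : ∀ s, J s → ℤ
  basis_mem : ∀ s j, basis s j ∈ grading s (deg s j)
  finite_type : ∀ s n, {j | deg s j = n}.Finite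

attribute [instance] FreeResolution.addCommGroup FreeResolution.moduleF2
  FreeResolution.moduleA FreeResolution.tower FreeResolution.order

/-! ### Curtis tables -/

section Curtis

/-- `b i` is the leading term of `x`: the largest basis element with nonzero coefficient
(over `𝔽₂` that coefficient is `1`). -/
def IsLeading {X I : Type*} [AddCommMonoid X] [Module (ZMod 2) X] [LinearOrder I]
    (b : Module.Basis I (ZMod 2) X) (x : X) (i : I) : Prop :=
  b.repr x i ≠ 0 ∧ ∀ j, i < j → b.repr x j = 0

/-- The items of a Curtis table: an untagged label `x`, or a tag `a ← b`. -/
inductive Item (P : Type*)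
  | untagged (x : P)
  | tag (a b : P)

/-- The label by which an item stands in its list: `x` for `x`, and `a` for `a ← b`. -/
def Item.head {P : Type*} : Item P → P
  | .untagged x => x
  | .tag a _ => a

/-- The label `y` appears in the item. -/
def Item.Contains {P : Type*} : Item P → P → Prop
  | .untagged x, y => y = x
  | .tag a b, y => y = a ∨ y = b

/-- `T` is a Curtis table of the complex `X₀ → X₁ → ⋯` with ordered bases `b s`. The list
`L_s` consists of the items of `T` whose head is a label of `X_s`. -/
structure IsCurtisTable {X : ℕ → Type*} [∀ s, AddCommMonoid (X s)] [∀ s, Module (ZMod 2) (X s)]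
    (d : ∀ s, X s →ₗ[ZMod 2] X (s + 1)) {I : ℕ → Type*} [∀ s, LinearOrder (I s)]
    (b : ∀ s, Module.Basis (I s) (ZMod 2) (X s)) (T : Set (Item (Σ s, I s))) : Prop where
  degree : ∀ a c, Item.tag a c ∈ T → a.1 = c.1 + 1
  once : ∀ x : Σ s, I s, ∃! it : Item (Σ s, I s), it ∈ T ∧ it.Contains x
  head_iff : ∀ x : Σ s, I s, (∃ it ∈ T, it.head = x) ↔
    ∃ z : X x.1, d x.1 z = 0 ∧ IsLeading (b x.1) z x.2
  tag_lift : ∀ (s : ℕ) (a : I (s + 1)) (c : I s), Item.tag ⟨s + 1, a⟩ ⟨s, c⟩ ∈ T →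
    ∃ y : X s, IsLeading (b s) y c ∧ IsLeading (b (s + 1)) (d s y) a

end Curtis

/-! ### The spectral sequence of a filtered complex -/

/-- A cochain complex of `𝔽₂`-vector spaces with an increasing filtration by subcomplexes. -/
structure FilteredComplex where
  X : ℕ → Type u
  [addCommGroup : ∀ s, AddCommGroup (X s)]
  [module : ∀ s, Module (ZMod 2) (X s)]
  d : ∀ s, X s →ₗ[ZMod 2] X (s + 1)
  d_d : ∀ s x, d (s + 1) (d s x) = 0
  fil : ℤ → ∀ s, Submodule (ZMod 2) (X s)
  fil_mono : ∀ m n, m ≤ n → ∀ s, fil m s ≤ fil n s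
  d_mem : ∀ n s x, x ∈ fil n s → d s x ∈ fil n (s + 1)

attribute [instance] FilteredComplex.addCommGroup FilteredComplex.module

namespace FilteredComplex

variable (C : FilteredComplex.{u})

/-- The image of `W` under the differential, in each degree. -/
def boundaries (W : ∀ s, Submodule (ZMod 2) (C.X s)) : ∀ s, Submodule (ZMod 2) (C.X s)
  | 0 => ⊥
  | s + 1 => (W s).map (C.d s)

/-- `Z_r^n = {x ∈ G_n : d x ∈ G_{n-r}}`. -/
def Z (r n : ℤ) (s : ℕ) : Submodule (ZMod 2) (C.X s) :=
  C.fil n s ⊓ (C.fil (n - r) (s + 1)).comap (C.d s)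

/-- `Z_{r-1}^{n-1} + d Z_{r-1}^{n+r-1}`. -/
def D (r n : ℤ) (s : ℕ) : Submodule (ZMod 2) (C.X s) :=
  C.Z (r - 1) (n - 1) s ⊔ C.boundaries (C.Z (r - 1) (n + r - 1)) s

/-- `E_r^n = Z_r^n / (Z_{r-1}^{n-1} + d Z_{r-1}^{n+r-1})`. -/
abbrev E (r n : ℤ) (s : ℕ) : Type u := ↥(C.Z r n s) ⧸ (C.D r n s).submoduleOf (C.Z r n s)

/-- `d` restricted to `Z_r^n → Z_r^{n-r}`. -/
def dZ (r n : ℤ) (s : ℕ) : C.Z r n s →ₗ[ZMod 2] C.Z r (n - r) (s + 1) :=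
  (C.d s).restrict fun x hx => by
    refine ⟨hx.2, ?_⟩
    simp [C.d_d]

theorem dZ_mem (r n : ℤ) (s : ℕ) :
    (C.D r n s).submoduleOf (C.Z r n s) ≤
      ((C.D r (n - r) (s + 1)).submoduleOf (C.Z r (n - r) (s + 1))).comap (C.dZ r n s) := by
  intro x hx
  change C.d s x.1 ∈ C.D r (n - r) (s + 1)
  change x.1 ∈ C.D r n s at hx
  obtain ⟨y, hy, z, hz, hyz⟩ := Submodule.mem_sup.1 hx
  have h0 : C.d s z = 0 := by
    cases s with
    | zero =>
      have : z = 0 := by simpa [boundaries] using hz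
      simp [this]
    | succ s =>
      obtain ⟨w, -, rfl⟩ := hz
      exact C.d_d _ _
  rw [← hyz, map_add, h0, add_zero]
  refine Submodule.mem_sup_right ?_
  have he : n - r + r - 1 = n - 1 := by ring
  exact ⟨y, by rw [he]; exact hy, rfl⟩

/-- The differential `d_r : E_r^n → E_r^{n-r}`. -/
def dE (r n : ℤ) (s : ℕ) : C.E r n s →ₗ[ZMod 2] C.E r (n - r) (s + 1) :=
  Submodule.mapQ _ _ (C.dZ r n s) (C.dZ_mem r n s)

/-- The whole page `E_r = ⨁_n E_r^n` in cohomological degree `s`. -/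
abbrev Page (r : ℤ) (s : ℕ) : Type u := DirectSum ℤ fun n => C.E r n s

/-- The differential `d_r` on the whole page. -/
noncomputable def dPage (r : ℤ) (s : ℕ) : C.Page r s →ₗ[ZMod 2] C.Page r (s + 1) :=
  DirectSum.toModule (ZMod 2) ℤ _ fun n =>
    DirectSum.lof (ZMod 2) ℤ (fun n => C.E r n (s + 1)) (n - r) ∘ₗ C.dE r n s

/-- The class in `E_r^n ⊆ E_r` of an element of `Z_r^n`. -/
noncomputable def cls (r n : ℤ) (s : ℕ) : C.Z r n s →ₗ[ZMod 2] C.Page r s :=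
  DirectSum.lof (ZMod 2) ℤ (fun n => C.E r n s) n ∘ₗ Submodule.mkQ _

/-- `Z_∞^n`: the cycles in `G_n`. -/
def Zinf (n : ℤ) (s : ℕ) : Submodule (ZMod 2) (C.X s) := C.fil n s ⊓ LinearMap.ker (C.d s)

/-- `E_∞^n = Z_∞^n / (Z_∞^{n-1} + G_n ∩ im d)`. -/
abbrev Einf (n : ℤ) (s : ℕ) : Type u :=
  ↥(C.Zinf n s) ⧸
    (C.Zinf (n - 1) s ⊔ C.fil n s ⊓ C.boundaries (fun _ => ⊤) s).submoduleOf (C.Zinf n s)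

/-- Compatible labels on the pages of the spectral sequence, with Curtis tables for all pages.
`wt i` is the filtration degree of the basis element `b s i`.
On `E₀` the labels are all basis elements, which represent themselves. The labels of `E_{r+1}` are
the untagged items of a Curtis table of `(E_r, d_r)`, and the label `i` denotes in
`E_{r+1} = H(E_r, d_r)` the class of a homogeneous `d_r`-cycle with leading term `i`
(such a cycle is the class of an element of `Z_{r+1}`). -/
structure LabelledPages {I : ℕ → Type w} [∀ s, LinearOrder (I s)]
    (b : ∀ s, Module.Basis (I s) (ZMod 2) (C.X s)) (wt : ∀ s, I s → ℤ) where
  U : ℕ → ∀ s, Set (I s)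
  β : ∀ (r s : ℕ), Module.Basis (U r s) (ZMod 2) (C.Page r s)
  T : ∀ r : ℕ, Set (Item (Σ s, U r s))
  U_zero : ∀ s, U 0 s = Set.univ
  β_zero : ∀ (s : ℕ) (i : U 0 s), ∃ h : b s i ∈ C.Z (0 : ℕ) (wt s i) s,
    β 0 s i = C.cls (0 : ℕ) (wt s i) s ⟨b s i, h⟩
  isCurtisTable : ∀ r : ℕ, IsCurtisTable (C.dPage r) (β r) (T r)
  U_succ : ∀ (r s : ℕ) (i : I s),
    i ∈ U (r + 1) s ↔ ∃ h : i ∈ U r s, Item.untagged ⟨s, ⟨i, h⟩⟩ ∈ T r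
  β_succ : ∀ (r s : ℕ) (i : U (r + 1) s),
    ∃ (h : i.1 ∈ U r s) (x : C.X s) (hx : x ∈ C.Z r (wt s i) s)
      (hx' : x ∈ C.Z (r + 1 : ℕ) (wt s i) s),
      IsLeading (β r s) (C.cls r (wt s i) s ⟨x, hx⟩) ⟨i.1, h⟩ ∧
      β (r + 1) s i = C.cls (r + 1 : ℕ) (wt s i) s ⟨x, hx'⟩

/-- The tags in the Curtis table of `(E_r, d_r)`: the table of the differential `d_r`. -/
def LabelledPages.tags {C : FilteredComplex.{u}} {I : ℕ → Type w} [∀ s, LinearOrder (I s)]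
    {b : ∀ s, Module.Basis (I s) (ZMod 2) (C.X s)} {wt : ∀ s, I s → ℤ}
    (P : C.LabelledPages b wt) (r : ℕ) : Set (Item (Σ s, I s)) :=
  {it | ∃ a c : Σ s, P.U r s, Item.tag a c ∈ P.T r ∧ it = Item.tag ⟨a.1, a.2.1⟩ ⟨c.1, c.2.1⟩}

end FilteredComplex

/-! ### The complexes `Hom_A(F_*, 𝔽₂)` and `Hom_A(M ⊗ F_*, 𝔽₂)` -/

namespace FreeResolution

variable (R : FreeResolution.{v, w})

/-- `Hom_A(F_s, 𝔽₂)` in internal degree `n`: the functionals on `F_s` that vanish on the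
image of `Sqⁱ` for `i > 0` and on the homogeneous elements of degree other than `n`. -/
def hom (n : ℤ) (s : ℕ) : Submodule (ZMod 2) (Module.Dual (ZMod 2) (R.F s)) where
  carrier := {φ | (∀ i, 0 < i → ∀ x, φ (sqEnd (R.F s) i x) = 0) ∧
    ∀ p, p ≠ n → ∀ x ∈ R.grading s p, φ x = 0}
  add_mem' {φ ψ} hφ hψ := ⟨fun i hi x => by simp [hφ.1 i hi x, hψ.1 i hi x],
    fun p hp x hx => by simp [hφ.2 p hp x hx, hψ.2 p hp x hx]⟩
  zero_mem' := by simp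
  smul_mem' c φ hφ := ⟨fun i hi x => by simp [hφ.1 i hi x],
    fun p hp x hx => by simp [hφ.2 p hp x hx]⟩

/-- The differential of `F_*` as an `𝔽₂`-linear map. -/
def bd₂ (s : ℕ) : R.F (s + 1) →ₗ[ZMod 2] R.F s := (R.bd s).restrictScalars (ZMod 2)

theorem bd₂_sq (s i : ℕ) : R.bd₂ s ∘ₗ sqEnd (R.F (s + 1)) i = sqEnd (R.F s) i ∘ₗ R.bd₂ s := by
  ext x
  exact map_smul (R.bd s) (Sq i) x

/-- The differential `φ ↦ φ ∘ ∂` of `Hom_A(F_*, 𝔽₂)`. -/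
def homD (n : ℤ) (s : ℕ) : R.hom n s →ₗ[ZMod 2] R.hom n (s + 1) :=
  (R.bd₂ s).dualMap.restrict fun φ hφ => by
    refine ⟨fun i hi x => ?_, fun p hp x hx => hφ.2 p hp _ (R.bd_mem s p x hx)⟩
    have := LinearMap.congr_fun (R.bd₂_sq s i) x
    simp only [LinearMap.comp_apply] at this
    rw [LinearMap.dualMap_apply, this]
    exact hφ.1 i hi _

/-- Labels of the dual basis `r_{s,j}` in internal degree `n`. -/
abbrev HomIndex (n : ℤ) (s : ℕ) : Type w := {j : R.J s // R.deg s j = n}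

/-- `ρ` is the basis `r_{s,j}` of `Hom_A(F_s, 𝔽₂)` dual to `r*_{s,j}`. -/
def IsDualHomBasis (ρ : ∀ n s, Module.Basis (R.HomIndex n s) (ZMod 2) (R.hom n s)) : Prop :=
  ∀ n s (j : R.HomIndex n s) (j' : R.J s),
    ((j.1 = j') → (ρ n s j).1 (R.basis s j') = 1) ∧
    ((j.1 ≠ j') → (ρ n s j).1 (R.basis s j') = 0)

variable {M : Type u} [AddCommGroup M] [Module (ZMod 2) M] [Module SteenrodAlgebra M]
  [IsScalarTower (ZMod 2) SteenrodAlgebra M] (𝓜 : ℤ → Submodule (ZMod 2) M)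

/-- `Hom_A(M ⊗ F_s, 𝔽₂)` in internal degree `t`, where the Steenrod algebra acts diagonally on
`M ⊗ F_s`: the functionals that vanish on the image of `Sqⁱ` for `i > 0` and on the homogeneous
elements of total degree other than `t`. -/
def cochain (t : ℤ) (s : ℕ) : Submodule (ZMod 2) (Module.Dual (ZMod 2) (M ⊗[ZMod 2] R.F s)) where
  carrier := {φ | (∀ i, 0 < i → ∀ x, φ (sqTensor M (R.F s) i x) = 0) ∧
    ∀ p q, p + q ≠ t → ∀ m ∈ 𝓜 p, ∀ f ∈ R.grading s q, φ (m ⊗ₜ f) = 0}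
  add_mem' {φ ψ} hφ hψ := ⟨fun i hi x => by simp [hφ.1 i hi x, hψ.1 i hi x],
    fun p q h m hm f hf => by simp [hφ.2 p q h m hm f hf, hψ.2 p q h m hm f hf]⟩
  zero_mem' := by simp
  smul_mem' c φ hφ := ⟨fun i hi x => by simp [hφ.1 i hi x],
    fun p q h m hm f hf => by simp [hφ.2 p q h m hm f hf]⟩

theorem lTensor_sq (s i : ℕ) :
    (R.bd₂ s).lTensor M ∘ₗ sqTensor M (R.F (s + 1)) i =
      sqTensor M (R.F s) i ∘ₗ (R.bd₂ s).lTensor M := by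
  ext x y
  have h := fun p : ℕ => LinearMap.congr_fun (R.bd₂_sq s p) y
  simp only [LinearMap.comp_apply] at h
  simp [sqTensor, h]

/-- The differential `φ ↦ φ ∘ (1 ⊗ ∂)` of `Hom_A(M ⊗ F_*, 𝔽₂)`. -/
noncomputable def cochainD (t : ℤ) (s : ℕ) :
    R.cochain 𝓜 t s →ₗ[ZMod 2] R.cochain 𝓜 t (s + 1) :=
  ((R.bd₂ s).lTensor M).dualMap.restrict fun φ hφ => by
    refine ⟨fun i hi x => ?_, fun p q h m hm f hf => ?_⟩
    · have := LinearMap.congr_fun (R.lTensor_sq (M := M) s i) x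
      simp only [LinearMap.comp_apply] at this
      rw [LinearMap.dualMap_apply, this]
      exact hφ.1 i hi _
    · rw [LinearMap.dualMap_apply, LinearMap.lTensor_tmul]
      exact hφ.2 p q h m hm _ (R.bd_mem s q f hf)

/-- The complex `Hom_A(M ⊗ F_*, 𝔽₂)` in internal degree `t`, filtered by the degree in `M`: the
`n`-th stage consists of the functionals that vanish on `M^{>n} ⊗ F_*`. Its spectral
sequence is the algebraic Atiyah–Hirzebruch spectral sequence of `M`. -/
noncomputable def ahComplex (t : ℤ) : FilteredComplex where
  X s := R.cochain 𝓜 t s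
  d s := R.cochainD 𝓜 t s
  d_d s φ := by
    ext x y
    have h : R.bd s (R.bd (s + 1) y) = 0 := (R.exact_succ s).apply_apply_eq_zero y
    change φ.1 ((R.bd₂ s).lTensor M ((R.bd₂ (s + 1)).lTensor M (x ⊗ₜ y))) = 0
    rw [LinearMap.lTensor_tmul, LinearMap.lTensor_tmul]
    change φ.1 (x ⊗ₜ R.bd s (R.bd (s + 1) y)) = 0
    rw [h, TensorProduct.tmul_zero, map_zero]
  fil n s :=
    { carrier := {φ | ∀ p, n < p → ∀ m ∈ 𝓜 p, ∀ f, φ.1 (m ⊗ₜ f) = 0}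
      add_mem' := fun {φ ψ} hφ hψ p hp m hm f => by simp [hφ p hp m hm f, hψ p hp m hm f]
      zero_mem' := by simp
      smul_mem' := fun c φ hφ p hp m hm f => by simp [hφ p hp m hm f] }
  fil_mono m n h s φ hφ p hp := hφ p (lt_of_le_of_lt h hp)
  d_mem n s φ hφ p hp m hm f := by
    change φ.1 ((R.bd₂ s).lTensor M (m ⊗ₜ f)) = 0
    rw [LinearMap.lTensor_tmul]
    exact hφ p hp m hm _

/-- Labels of the dual basis `e_k ⊗ r_{s,j}` in internal degree `t`, in lexicographic order;
`degM k` is the degree of `e_k`. -/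
abbrev Index {K : Type*} (degM : K → ℤ) (t : ℤ) (s : ℕ) : Type _ :=
  {p : K ×ₗ R.J s // degM (ofLex p).1 + R.deg s (ofLex p).2 = t}

/-- The filtration degree of `e_k ⊗ r_{s,j}`: the degree of `e_k`. -/
def wt {K : Type*} (degM : K → ℤ) (t : ℤ) (s : ℕ) (p : R.Index degM t s) : ℤ :=
  degM (ofLex p.1).1

/-- `β` is the basis `e_k ⊗ r_{s,j}` of `Hom_A(M ⊗ F_s, 𝔽₂)` dual to `e*_k ⊗ r*_{s,j}`. -/
def IsDualBasis {K : Type*} (e : Module.Basis K (ZMod 2) M) (degM : K → ℤ)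
    (β : ∀ t s, Module.Basis (R.Index degM t s) (ZMod 2) ((R.ahComplex 𝓜 t).X s)) : Prop :=
  ∀ t s (p : R.Index degM t s) (k' : K) (j' : R.J s),
    ((ofLex p.1 = (k', j')) →
      (show R.cochain 𝓜 t s from β t s p).1 (e k' ⊗ₜ R.basis s j') = 1) ∧
    ((ofLex p.1 ≠ (k', j')) →
      (show R.cochain 𝓜 t s from β t s p).1 (e k' ⊗ₜ R.basis s j') = 0)

/-- The tags `e_k ⊗ a ← e_k ⊗ c` in internal degree `t`, for the tags `a ← c` in the Curtis
tables `TF n` of `Hom_A(F_*, 𝔽₂)` (one for each internal degree `n`). -/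
def resolutionTags {K : Type*} (degM : K → ℤ) (TF : ∀ n, Set (Item (Σ s, R.HomIndex n s)))
    (t : ℤ) : Set (Item (Σ s, R.Index degM t s)) :=
  {it | ∃ (k : K) (n : ℤ) (h : degM k + n = t) (a c : Σ s, R.HomIndex n s),
    Item.tag a c ∈ TF n ∧
    it = Item.tag ⟨a.1, toLex (k, a.2.1), by simpa [a.2.2] using h⟩
      ⟨c.1, toLex (k, c.2.1), by simpa [c.2.2] using h⟩}

end FreeResolution

end CurtisAHSS

/-!
A Curtis table amounts to a change of basis, unitriangular with respect to leading terms, which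
brings the complex into canonical form: the new basis elements `g` satisfy `d g_c = g_a` for every
tag `a ← c` and `d g_c = 0` otherwise. In such a basis `c` is the least leading term of an element
whose boundary has leading term `a`; this condition does not mention the table, hence uniqueness,
and conversely it defines a matching, hence existence.

In the lexicographic order the leading term of an element of `C^*` determines its filtration degree.
The canonical basis is therefore adapted to the filtration, the modules of cycles and boundaries
that define the pages are spanned by basis elements, and the spectral sequence can be read off: a
tag along which the degree of `e_k` drops by `r` is a nonzero value of `d_r`, and the untagged items
survive to `E_∞`. The page `E_0` is a sum of copies of `Hom_A(F_*, 𝔽₂)`, one for each `e_k`, so the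
tags of drop zero are those of the resolution.

The dual bases exist because the antipode `χ` untwists the diagonal action on `M ⊗ F_s`. That `χ` is
compatible with the Adem relations follows from their equivalence with the Bullett–Macdonald
identity, a product formula for total squares that can be inverted.
-/

namespace CurtisAHSS

universe u v w

/-! ### The Adem relations and the Bullett–Macdonald identity -/

section BullettMacdonald

open Polynomial Finset

theorem sum_coeff_mul_smul_congr {ι R B : Type*} [CommSemiring R] [AddCommMonoid B] [Module R B]
    {S : Finset ι} {x : ι → B} {f g : ι → R[X]}
    (h : ∀ i, ∑ p ∈ S, (f p).coeff i • x p = ∑ p ∈ S, (g p).coeff i • x p)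
    (V : PowerSeries R) (a : ℕ) :
    ∑ p ∈ S, PowerSeries.coeff a ((f p : PowerSeries R) * V) • x p =
      ∑ p ∈ S, PowerSeries.coeff a ((g p : PowerSeries R) * V) • x p := by
  have h_expand : ∀ f : ι → R[X],
      ∑ p ∈ S, PowerSeries.coeff a ((f p : PowerSeries R) * V) • x p =
      ∑ q ∈ antidiagonal a, PowerSeries.coeff q.2 V • ∑ p ∈ S, (f p).coeff q.1 • x p := by
    intro f
    simp only [PowerSeries.coeff_mul, Finset.sum_smul, Finset.smul_sum, Polynomial.coeff_coe]
    rw [Finset.sum_comm]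
    simp only [smul_smul, mul_comm]
  simp only [h_expand, h]

theorem exists_forall_sum_smul_eq {R B : Type*} [Ring R] [AddCommGroup B] [Module R B]
    (c : ℕ → ℕ → R) (hc : ∀ m, c m m = 1) (z : ℕ → B) :
    ∃ y : ℕ → B, ∀ m, ∑ j ∈ range (m + 1), c m j • y j = z m := by
  let y : ℕ → B := fun m => WellFounded.fix (C := fun _ => B) wellFounded_lt
    (fun m y => z m - ∑ j : Fin m, c m j • y j j.2) m
  refine ⟨y, fun m => ?_⟩
  have hy : y m = z m - ∑ j : Fin m, c m j • y j := WellFounded.fix_eq ..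
  rw [Finset.sum_range_succ, hc, one_smul, hy, Finset.sum_range (fun j => c m j • y j)]
  exact add_sub_cancel _ _

variable {B : Type*} [AddCommGroup B] [Module (ZMod 2) B]

/-- The degree `n` part of the Bullett–Macdonald identity `P(s² + s) P(1) = P(1 + s) P(s²)`, where
`P(u) = ∑ uᵃ Sqᵃ`, for a family `x (a, b)` in place of the products `Sqᵃ Sqᵇ`. The two sides are
compared coefficient by coefficient in `s`. -/
def BullettMacdonald (x : ℕ × ℕ → B) (n : ℕ) : Prop :=
  ∀ i, ∑ p ∈ antidiagonal n, ((X + X ^ 2 : (ZMod 2)[X]) ^ p.1).coeff i • x p =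
    ∑ p ∈ antidiagonal n, ((1 + X : (ZMod 2)[X]) ^ p.1 * X ^ (2 * p.2)).coeff i • x p

/-- The Adem relation for a family `x (a, b)` in place of the products `Sqᵃ Sqᵇ`. -/
def AdemAt (x : ℕ × ℕ → B) (a b : ℕ) : Prop :=
  x (a, b) = ∑ j ∈ range (a / 2 + 1),
    (Nat.choose (b - 1 - j) (a - 2 * j) : ZMod 2) • x (a + b - j, j)

theorem one_add_X_mul_mk_one :
    (1 + PowerSeries.X : PowerSeries (ZMod 2)) * PowerSeries.mk 1 = 1 := by
  have h_sub : (1 - PowerSeries.X : PowerSeries (ZMod 2)) = 1 + PowerSeries.X := by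
    ext n
    rw [map_sub, map_add, CharTwo.sub_eq_add]
  rw [← h_sub, mul_comm, PowerSeries.mk_one_mul_one_sub_eq_one]

theorem one_add_X_pow_mul_mk_one_pow (k l : ℕ) :
    (1 + PowerSeries.X : PowerSeries (ZMod 2)) ^ k * PowerSeries.mk 1 ^ (k + l) =
      PowerSeries.mk 1 ^ l := by
  rw [pow_add, ← mul_assoc, ← mul_pow, one_add_X_mul_mk_one, one_pow, one_mul]

theorem one_add_X_pow_add_mul_mk_one_pow (k l : ℕ) :
    (1 + PowerSeries.X : PowerSeries (ZMod 2)) ^ (l + k) * PowerSeries.mk 1 ^ k =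
      (1 + PowerSeries.X) ^ l := by
  rw [pow_add, mul_assoc, ← mul_pow, one_add_X_mul_mk_one, one_pow, mul_one]

/- The coefficient of `sᵃ` in `(s + s²)ᵏ (1 + s)⁻ᵃ⁻¹` is the residue of `uᵏ⁻ᵃ⁻¹ du` for `u = s + s²`
(note that `du = ds`), hence the Kronecker delta. -/
theorem coeff_X_add_X_sq_pow_mul_mk_one_pow (a k : ℕ) :
    PowerSeries.coeff a ((((X + X ^ 2) ^ k : (ZMod 2)[X]) : PowerSeries (ZMod 2)) *
      PowerSeries.mk 1 ^ (a + 1)) = if k = a then 1 else 0 := by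
  have h_factor : (((X + X ^ 2 : (ZMod 2)[X]) ^ k : (ZMod 2)[X]) : PowerSeries (ZMod 2)) =
      PowerSeries.X ^ k * (1 + PowerSeries.X) ^ k := by
    rw [show (X + X ^ 2 : (ZMod 2)[X]) = X * (1 + X) by ring, mul_pow]
    simp
  rw [h_factor, mul_assoc, PowerSeries.coeff_X_pow_mul']
  rcases lt_trichotomy k a with h | rfl | h
  · obtain ⟨m, rfl⟩ := Nat.exists_eq_add_of_lt h
    rw [if_pos (by omega), if_neg (by omega), show k + m + 1 + 1 = k + (m + 1 + 1) by ring,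
      one_add_X_pow_mul_mk_one_pow, PowerSeries.mk_one_pow_eq_mk_choose_add,
      show k + m + 1 - k = m + 1 by omega, PowerSeries.coeff_mk]
    have h_even := Nat.two_dvd_centralBinom_of_one_le (n := m + 1) (by omega)
    rw [Nat.centralBinom_eq_two_mul_choose, two_mul] at h_even
    exact (ZMod.natCast_eq_zero_iff _ 2).2 h_even
  · rw [if_pos le_rfl, if_pos rfl, one_add_X_pow_mul_mk_one_pow]
    simp
  · rw [if_neg (by omega), if_neg (by omega)]

theorem coeff_one_add_X_pow_mul_mk_one_pow {a b k j : ℕ} (hkj : k + j = a + b)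
    (hab : a < 2 * b) :
    PowerSeries.coeff a ((((1 + X : (ZMod 2)[X]) ^ k * X ^ (2 * j) : (ZMod 2)[X]) :
        PowerSeries (ZMod 2)) * PowerSeries.mk 1 ^ (a + 1)) =
      if 2 * j ≤ a then (Nat.choose (b - 1 - j) (a - 2 * j) : ZMod 2) else 0 := by
  have h_coe : (((1 + X : (ZMod 2)[X]) ^ k * X ^ (2 * j) : (ZMod 2)[X]) :
      PowerSeries (ZMod 2)) = PowerSeries.X ^ (2 * j) * (1 + PowerSeries.X) ^ k := by
    simp [mul_comm]
  rw [h_coe, mul_assoc, PowerSeries.coeff_X_pow_mul']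
  split_ifs with hj
  · rw [show k = (b - 1 - j) + (a + 1) by omega, one_add_X_pow_add_mul_mk_one_pow,
      show (1 + PowerSeries.X : PowerSeries (ZMod 2)) ^ (b - 1 - j) =
        (((1 + X : (ZMod 2)[X]) ^ (b - 1 - j) : (ZMod 2)[X]) : PowerSeries (ZMod 2)) by simp,
      Polynomial.coeff_coe, Polynomial.coeff_one_add_X_pow]
  · rfl

theorem BullettMacdonald.ademAt {x : ℕ × ℕ → B} {a b : ℕ} (h : BullettMacdonald x (a + b))
    (hab : a < 2 * b) : AdemAt x a b := by
  have h_coeff := sum_coeff_mul_smul_congr h (PowerSeries.mk 1 ^ (a + 1)) a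
  have h_left : ∑ p ∈ antidiagonal (a + b), (if p.1 = a then 1 else 0 : ZMod 2) • x p =
      x (a, b) := by
    rw [Finset.sum_eq_single (a, b) _ (by simp), if_pos rfl, one_smul]
    rintro ⟨k, l⟩ hkl hne
    rw [HasAntidiagonal.mem_antidiagonal] at hkl
    rw [if_neg, zero_smul]
    rintro rfl
    exact hne (by simpa using hkl)
  simp only [coeff_X_add_X_sq_pow_mul_mk_one_pow, h_left] at h_coeff
  rw [AdemAt, h_coeff, Finset.sum_congr rfl fun p hp => by
    rw [coeff_one_add_X_pow_mul_mk_one_pow (HasAntidiagonal.mem_antidiagonal.1 hp) hab],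
    ← Finset.Nat.sum_antidiagonal_swap]
  simp only [Prod.swap]
  rw [Finset.Nat.sum_antidiagonal_eq_sum_range_succ_mk]
  symm
  refine Finset.sum_subset_zero_on_sdiff (fun j => ?_) (fun j hj => ?_) fun j hj => ?_
  · simp only [Finset.mem_range]
    omega
  · simp only [Finset.mem_sdiff, Finset.mem_range] at hj
    rw [if_neg (by omega), zero_smul]
  · simp only [Finset.mem_range] at hj
    rw [if_pos (by omega)]

/-- The coefficient of `Aᵃ Bᵇ` in `(A + B)^(n-3j) (A²B)^j`, where `a + b = n`. For `A = s + s²`,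
`B = 1` as well as for `A = 1 + s`, `B = s²` one has `A + B = 1 + s + s²` and `A²B = s² (1 + s)²`,
so these families satisfy the Bullett–Macdonald identity. -/
def dicksonCoeff (n j : ℕ) (p : ℕ × ℕ) : ZMod 2 :=
  if j ≤ p.2 then (Nat.choose (n - 3 * j) (p.2 - j) : ZMod 2) else 0

theorem sum_dicksonCoeff {n j : ℕ} (hj : 3 * j ≤ n) (f g : (ZMod 2)[X]) :
    ∑ p ∈ antidiagonal n, C (dicksonCoeff n j p) * (f ^ p.1 * g ^ p.2) =
      (f + g) ^ (n - 3 * j) * (f ^ (2 * j) * g ^ j) := by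
  rw [add_comm f g, (Commute.all g f).add_pow', Finset.sum_mul]
  symm
  refine Finset.sum_of_injOn (fun p => (p.2 + 2 * j, p.1 + j)) ?_ ?_ ?_ ?_
  · rintro ⟨a, b⟩ _ ⟨c, d⟩ _ h
    simp only [Prod.mk.injEq] at h ⊢
    omega
  · rintro ⟨a, b⟩ h
    simp only [mem_coe, HasAntidiagonal.mem_antidiagonal] at h ⊢
    omega
  · rintro ⟨a, b⟩ h h_notMem
    simp only [HasAntidiagonal.mem_antidiagonal] at h
    simp only [dicksonCoeff]
    split_ifs with hb
    · rw [Nat.choose_eq_zero_of_lt, Nat.cast_zero, C_0, zero_mul]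
      by_contra! hc
      refine h_notMem ⟨(b - j, a - 2 * j), ?_, ?_⟩
      · simp only [mem_coe, HasAntidiagonal.mem_antidiagonal]
        omega
      · simp only [Prod.mk.injEq]
        omega
    · simp
  · rintro ⟨a, b⟩ _
    simp only [dicksonCoeff, le_add_iff_nonneg_left, zero_le, if_true, Nat.add_sub_cancel,
      nsmul_eq_mul, map_natCast]
    ring

theorem bullettMacdonald_dicksonCoeff {n j : ℕ} (hj : 3 * j ≤ n) :
    BullettMacdonald (dicksonCoeff n j) n := by
  have h_poly : ∑ p ∈ antidiagonal n, C (dicksonCoeff n j p) * ((X + X ^ 2) ^ p.1 * 1 ^ p.2) =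
      ∑ p ∈ antidiagonal n, C (dicksonCoeff n j p) * ((1 + X) ^ p.1 * (X ^ 2) ^ p.2) := by
    rw [sum_dicksonCoeff hj, sum_dicksonCoeff hj,
      show (X + X ^ 2 + 1 : (ZMod 2)[X]) = 1 + X + X ^ 2 by ring,
      show (X + X ^ 2 : (ZMod 2)[X]) = (1 + X) * X by ring, mul_pow, one_pow, mul_one, ← pow_mul]
  intro i
  have h_coeff := congrArg (fun q => q.coeff i) h_poly
  simp only [finsetSum_coeff, coeff_C_mul, one_pow, mul_one, ← pow_mul] at h_coeff
  simpa only [smul_eq_mul, mul_comm] using h_coeff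

theorem BullettMacdonald.smul_const {f : ℕ × ℕ → ZMod 2} {n : ℕ} (h : BullettMacdonald f n)
    (y : B) : BullettMacdonald (fun p => f p • y) n := fun i => by
  simpa only [Finset.sum_smul, smul_assoc] using congrArg (fun c : ZMod 2 => c • y) (h i)

theorem BullettMacdonald.sum {ι : Type*} (S : Finset ι) {x : ι → ℕ × ℕ → B} {n : ℕ}
    (h : ∀ j ∈ S, BullettMacdonald (x j) n) : BullettMacdonald (fun p => ∑ j ∈ S, x j p) n := by
  intro i
  simp only [Finset.smul_sum]
  rw [Finset.sum_comm, Finset.sum_comm (s := antidiagonal n)]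
  exact Finset.sum_congr rfl fun j hj => h j hj i

theorem BullettMacdonald.congr {x y : ℕ × ℕ → B} {n : ℕ} (h : BullettMacdonald x n)
    (hxy : ∀ p ∈ antidiagonal n, x p = y p) : BullettMacdonald y n := fun i => by
  rw [← Finset.sum_congr rfl fun p hp => congrArg _ (hxy p hp), h i]
  exact Finset.sum_congr rfl fun p hp => congrArg _ (hxy p hp)

/- The Adem relations express all `x p` through the admissible `x (n - m, m)`, `3m ≤ n`, and the
Dickson families, which are unitriangular there, interpolate any admissible values. -/
theorem bullettMacdonald_of_ademAt {x : ℕ × ℕ → B} {n : ℕ}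
    (h : ∀ a b, a + b = n → a < 2 * b → AdemAt x a b) : BullettMacdonald x n := by
  obtain ⟨y, hy⟩ := exists_forall_sum_smul_eq (fun m j => dicksonCoeff n j (n - m, m))
    (by simp [dicksonCoeff]) fun m => x (n - m, m)
  set w : ℕ × ℕ → B := fun p => ∑ j ∈ range (n / 3 + 1), dicksonCoeff n j p • y j with hw
  have h_bm : BullettMacdonald w n := BullettMacdonald.sum _ fun j hj =>
    (bullettMacdonald_dicksonCoeff (by simp only [Finset.mem_range] at hj; omega)).smul_const _
  have h_admissible : ∀ m, 3 * m ≤ n → w (n - m, m) = x (n - m, m) := by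
    intro m hm
    rw [← hy m, hw]
    symm
    refine Finset.sum_subset (fun j => ?_) fun j _ hj => ?_
    · simp only [Finset.mem_range]
      omega
    · simp only [Finset.mem_range] at hj
      rw [dicksonCoeff, if_neg (by simp only; omega), zero_smul]
  refine h_bm.congr fun ⟨a, b⟩ hp => ?_
  rw [HasAntidiagonal.mem_antidiagonal] at hp
  by_cases hab : a < 2 * b
  · rw [h a b hp hab, (hp ▸ h_bm : BullettMacdonald w (a + b)).ademAt hab]
    refine Finset.sum_congr rfl fun j hj => ?_
    simp only [Finset.mem_range] at hj
    rw [hp, h_admissible j (by omega)]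
  · rw [show a = n - b by omega]
    exact h_admissible b (by omega)

end BullettMacdonald

/-! ### The antipode of the Steenrod algebra -/

section Antipode

open Polynomial Finset

section ScaledSeries

variable {R A : Type*} [CommRing R] [Ring A] [Algebra R A]

attribute [local instance] Polynomial.algebra

theorem coeff_smul_C (w : R[X]) (x : A) (i : ℕ) :
    (w • C x : A[X]).coeff i = w.coeff i • x := by
  rw [Algebra.smul_def, algebraMap_def, coe_mapRingHom, coeff_mul_C, coeff_map, Algebra.smul_def]

/-- The ring homomorphism `∑ aₙ τⁿ ↦ ∑ aₙ uⁿ τⁿ`, for a polynomial `u` with central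
coefficients. -/
noncomputable def scaledSeries (u : R[X]) : PowerSeries A →+* PowerSeries A[X] where
  toFun a := PowerSeries.mk fun n => u ^ n • C (PowerSeries.coeff n a)
  map_zero' := by ext; simp
  map_one' := by
    ext1 n
    rcases eq_or_ne n 0 with rfl | hn <;> simp [PowerSeries.coeff_one, *]
  map_add' a b := by ext1; simp
  map_mul' a b := by
    ext1 n
    simp only [PowerSeries.coeff_mk, PowerSeries.coeff_mul, map_sum, C_mul, Finset.smul_sum,
      smul_mul_smul_comm, ← pow_add]
    exact Finset.sum_congr rfl fun p hp => by rw [HasAntidiagonal.mem_antidiagonal.1 hp]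

theorem coeff_coeff_scaledSeries_mul (a b : PowerSeries A) (u v : R[X]) (n i : ℕ) :
    (PowerSeries.coeff n (scaledSeries u a * scaledSeries v b)).coeff i =
      ∑ p ∈ antidiagonal n, (u ^ p.1 * v ^ p.2).coeff i •
        (PowerSeries.coeff p.1 a * PowerSeries.coeff p.2 b) := by
  simp only [scaledSeries, RingHom.coe_mk, MonoidHom.coe_mk, OneHom.coe_mk, PowerSeries.coeff_mul,
    PowerSeries.coeff_mk, smul_mul_smul_comm, ← C_mul, finsetSum_coeff, coeff_smul_C]

theorem scaledSeries_mul_eq_one {a b : PowerSeries A} (h : a * b = 1) (u : R[X]) :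
    scaledSeries u a * scaledSeries u b = 1 := by
  rw [← map_mul, h, map_one]

end ScaledSeries

theorem Sq_zero : Sq 0 = 1 := by
  rw [Sq, RingQuot.mkAlgHom_rel (ZMod 2) AdemRel.sq_zero, map_one]

theorem ademAt_Sq {a b : ℕ} (hab : a < 2 * b) :
    AdemAt (fun p : ℕ × ℕ => Sq p.1 * Sq p.2) a b := by
  rw [AdemAt]
  rcases Nat.eq_zero_or_pos a with rfl | ha
  · simp [Sq_zero]
  · simpa only [map_mul, map_sum, map_smul, Sq] using
      RingQuot.mkAlgHom_rel (ZMod 2) (AdemRel.adem a b ha hab)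

/-- The total square `∑ Sqⁿ τⁿ`. -/
noncomputable def totalSq : PowerSeries SteenrodAlgebra := PowerSeries.mk Sq

/-- The inverse of the total square. -/
noncomputable def totalConjSq : PowerSeries SteenrodAlgebra := PowerSeries.invOfUnit totalSq 1

/-- The conjugate square `χ(Sqⁿ)`, a coefficient of the inverse of the total square. -/
noncomputable def conjSq (n : ℕ) : SteenrodAlgebra := PowerSeries.coeff n totalConjSq

theorem constantCoeff_totalSq :
    PowerSeries.constantCoeff totalSq = ((1 : SteenrodAlgebraˣ) :) := by
  rw [← PowerSeries.coeff_zero_eq_constantCoeff_apply, totalSq, PowerSeries.coeff_mk, Sq_zero,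
    Units.val_one]

theorem totalSq_mul_totalConjSq : totalSq * totalConjSq = 1 :=
  PowerSeries.mul_invOfUnit _ _ constantCoeff_totalSq

theorem totalConjSq_mul_totalSq : totalConjSq * totalSq = 1 :=
  PowerSeries.invOfUnit_mul _ _ constantCoeff_totalSq

theorem conjSq_zero : conjSq 0 = 1 := by
  simpa [PowerSeries.coeff_mul, totalSq, conjSq, Sq_zero] using
    congrArg (PowerSeries.coeff 0) totalSq_mul_totalConjSq

theorem sum_conjSq_mul_Sq {n : ℕ} (hn : 0 < n) :
    ∑ p ∈ antidiagonal n, conjSq p.1 * Sq p.2 = 0 := by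
  simpa only [PowerSeries.coeff_mul, totalSq, conjSq, PowerSeries.coeff_mk,
    PowerSeries.coeff_one, hn.ne', if_false] using
    congrArg (PowerSeries.coeff n) totalConjSq_mul_totalSq

theorem scaledSeries_totalSq :
    scaledSeries (X + X ^ 2 : (ZMod 2)[X]) totalSq * scaledSeries (1 : (ZMod 2)[X]) totalSq =
      scaledSeries (1 + X : (ZMod 2)[X]) totalSq *
        scaledSeries (X ^ 2 : (ZMod 2)[X]) totalSq := by
  ext n i
  simpa only [coeff_coeff_scaledSeries_mul, totalSq, PowerSeries.coeff_mk, one_pow, mul_one,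
    ← pow_mul] using bullettMacdonald_of_ademAt (n := n) (fun a b _ hab => ademAt_Sq hab) i

theorem scaledSeries_totalConjSq :
    scaledSeries (1 : (ZMod 2)[X]) totalConjSq *
        scaledSeries (X + X ^ 2 : (ZMod 2)[X]) totalConjSq =
      scaledSeries (X ^ 2 : (ZMod 2)[X]) totalConjSq *
        scaledSeries (1 + X : (ZMod 2)[X]) totalConjSq := by
  have hr := scaledSeries_mul_eq_one (R := ZMod 2) totalSq_mul_totalConjSq
  have hl := scaledSeries_mul_eq_one (R := ZMod 2) totalConjSq_mul_totalSq
  refine left_inv_eq_right_inv (a := scaledSeries (X + X ^ 2 : (ZMod 2)[X]) totalSq *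
    scaledSeries (1 : (ZMod 2)[X]) totalSq) ?_ ?_
  · rw [mul_assoc, ← mul_assoc _ (scaledSeries (X + X ^ 2) totalSq), hl, one_mul, hl]
  · rw [scaledSeries_totalSq, mul_assoc, ← mul_assoc (scaledSeries (X ^ 2) totalSq), hr, one_mul,
      hr]

/- Inverting the Bullett–Macdonald identity reverses the products, so the conjugate squares satisfy
it in the opposite algebra. -/
theorem ademAt_conjSq {a b : ℕ} (hab : a < 2 * b) :
    AdemAt (fun p : ℕ × ℕ => conjSq p.2 * conjSq p.1) a b := by
  refine BullettMacdonald.ademAt (fun i => ?_) hab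
  have h := congrArg (fun f => (PowerSeries.coeff (a + b) f).coeff i) scaledSeries_totalConjSq
  simp only [coeff_coeff_scaledSeries_mul] at h
  rw [← Finset.Nat.sum_antidiagonal_swap, ← Finset.Nat.sum_antidiagonal_swap (n := a + b)
    (f := fun p => ((X ^ 2) ^ p.1 * (1 + X) ^ p.2 : (ZMod 2)[X]).coeff i • _)] at h
  simpa only [conjSq, Prod.fst_swap, Prod.snd_swap, one_pow, one_mul, ← pow_mul,
    mul_comm (X ^ _) ((1 + X : (ZMod 2)[X]) ^ _)] using h

/-- The antipode of the Steenrod algebra, as a homomorphism to the opposite algebra. -/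
noncomputable def antipode : SteenrodAlgebra →ₐ[ZMod 2] SteenrodAlgebraᵐᵒᵖ :=
  RingQuot.liftAlgHom (ZMod 2) ⟨FreeAlgebra.lift (ZMod 2) fun i => MulOpposite.op (conjSq i), by
    intro x y hxy
    cases hxy with
    | sq_zero => simp [conjSq_zero]
    | adem a b ha hab =>
      have h := congrArg MulOpposite.op (ademAt_conjSq hab)
      rw [MulOpposite.op_mul] at h
      simp only [map_mul, map_sum, map_smul, FreeAlgebra.lift_ι_apply, h]
      simp⟩

theorem antipode_Sq (i : ℕ) : antipode (Sq i) = MulOpposite.op (conjSq i) := by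
  rw [antipode, Sq, RingQuot.liftAlgHom_mkAlgHom_apply, FreeAlgebra.lift_ι_apply]

/-- Conjugation in the Steenrod algebra: the antipode as a linear map. -/
noncomputable def conj : SteenrodAlgebra →ₗ[ZMod 2] SteenrodAlgebra :=
  (MulOpposite.opLinearEquiv (ZMod 2)).symm.toLinearMap ∘ₗ antipode.toLinearMap

theorem conj_one : conj 1 = 1 := by simp [conj]

theorem conj_mul (a b : SteenrodAlgebra) : conj (a * b) = conj b * conj a := by simp [conj]

theorem conj_Sq (i : ℕ) : conj (Sq i) = conjSq i := by simp [conj, antipode_Sq]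

/-- The augmentation of the Steenrod algebra. -/
noncomputable def augmentation : SteenrodAlgebra →ₐ[ZMod 2] ZMod 2 :=
  RingQuot.liftAlgHom (ZMod 2) ⟨FreeAlgebra.lift (ZMod 2) fun i => if i = 0 then 1 else 0, by
    intro x y hxy
    cases hxy with
    | sq_zero => simp
    | adem a b ha hab =>
      simp only [map_mul, map_sum, map_smul, FreeAlgebra.lift_ι_apply]
      rw [if_neg ha.ne', zero_mul, Finset.sum_eq_zero]
      intro j hj
      simp only [Finset.mem_range] at hj
      rw [if_neg (by omega), zero_mul, smul_zero]⟩

theorem augmentation_Sq {i : ℕ} (hi : 0 < i) : augmentation (Sq i) = 0 := by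
  rw [augmentation, Sq, RingQuot.liftAlgHom_mkAlgHom_apply, FreeAlgebra.lift_ι_apply,
    if_neg hi.ne']

end Antipode

/-! ### Monomials in the Steenrod squares and graded modules -/

section Monomials

open scoped Pointwise

/-- `a` is a product of Steenrod squares of total degree `n`. -/
inductive IsMonomial : ℕ → SteenrodAlgebra → Prop
  | one : IsMonomial 0 1
  | sq_mul (i : ℕ) {n : ℕ} {a : SteenrodAlgebra} (h : IsMonomial n a) :
      IsMonomial (i + n) (Sq i * a)

theorem adjoin_range_Sq : Algebra.adjoin (ZMod 2) (Set.range Sq) = ⊤ := by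
  have h_range : Set.range Sq =
      RingQuot.mkAlgHom (ZMod 2) AdemRel '' Set.range (FreeAlgebra.ι (ZMod 2)) := by
    rw [← Set.range_comp]
    rfl
  rw [h_range, ← AlgHom.map_adjoin, FreeAlgebra.adjoin_range_ι, Algebra.map_top,
    AlgHom.range_eq_top]
  exact RingQuot.mkAlgHom_surjective _ _

theorem exists_isMonomial_of_mem_closure {a : SteenrodAlgebra}
    (ha : a ∈ Submonoid.closure (Set.range Sq)) : ∃ n, IsMonomial n a := by
  induction ha using Submonoid.closure_induction_left with
  | one => exact ⟨0, .one⟩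
  | mul_left x hx y _ ih =>
    obtain ⟨⟨i, rfl⟩, n, hn⟩ := And.intro hx ih
    exact ⟨i + n, hn.sq_mul i⟩

theorem span_isMonomial : Submodule.span (ZMod 2) {a | ∃ n, IsMonomial n a} = ⊤ := by
  rw [eq_top_iff, ← Algebra.top_toSubmodule, ← adjoin_range_Sq, Algebra.adjoin_eq_span]
  exact Submodule.span_mono fun a => exists_isMonomial_of_mem_closure

theorem IsMonomial.augmentation_eq_zero {n : ℕ} {a : SteenrodAlgebra} (h : IsMonomial n a)
    (hn : n ≠ 0) : augmentation a = 0 := by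
  induction h with
  | one => exact absurd rfl hn
  | sq_mul i _ ih =>
    rw [map_mul]
    rcases Nat.eq_zero_or_pos i with rfl | hi
    · rw [ih (by omega), mul_zero]
    · rw [augmentation_Sq hi, zero_mul]

variable {M : Type*} [AddCommGroup M] [Module (ZMod 2) M] [Module SteenrodAlgebra M]
  {𝓜 : ℤ → Submodule (ZMod 2) M}

theorem IsGradedModule.conjSq_smul_mem (h : IsGradedModule 𝓜) (i : ℕ) :
    ∀ {p : ℤ} {x : M}, x ∈ 𝓜 p → conjSq i • x ∈ 𝓜 (p + i) := by
  induction i using Nat.strong_induction_on with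
  | _ i ih =>
    intro p x hx
    rcases Nat.eq_zero_or_pos i with rfl | hi
    · simpa [conjSq_zero] using hx
    have h_rec := sum_conjSq_mul_Sq hi
    have h_mem : (i, 0) ∈ Finset.HasAntidiagonal.antidiagonal i := by simp
    rw [← Finset.add_sum_erase _ _ h_mem, Sq_zero, mul_one] at h_rec
    rw [eq_neg_of_add_eq_zero_left h_rec, neg_smul, Finset.sum_smul]
    refine Submodule.neg_mem _ (Submodule.sum_mem _ ?_)
    rintro ⟨a, b⟩ hab
    simp only [Finset.mem_erase, Finset.HasAntidiagonal.mem_antidiagonal, ne_eq,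
      Prod.mk.injEq] at hab
    rw [mul_smul, show p + (i : ℤ) = p + b + a by omega]
    exact ih a (by omega) (h.sq_mem b p x hx)

theorem IsMonomial.smul_mem (h : IsGradedModule 𝓜) {n : ℕ} {a : SteenrodAlgebra}
    (ha : IsMonomial n a) {p : ℤ} {x : M} (hx : x ∈ 𝓜 p) : a • x ∈ 𝓜 (p + n) := by
  induction ha with
  | one => simpa using hx
  | @sq_mul i n a _ ih =>
    rw [mul_smul, show p + ((i + n : ℕ) : ℤ) = p + n + i by push_cast; ring]
    exact h.sq_mem i _ _ ih

theorem IsMonomial.conj_smul_mem (h : IsGradedModule 𝓜) {n : ℕ} {a : SteenrodAlgebra}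
    (ha : IsMonomial n a) {p : ℤ} {x : M} (hx : x ∈ 𝓜 p) : conj a • x ∈ 𝓜 (p + n) := by
  induction ha generalizing p x with
  | one => simpa [conj_one] using hx
  | @sq_mul i n a _ ih =>
    rw [conj_mul, conj_Sq, mul_smul, show p + ((i + n : ℕ) : ℤ) = p + i + n by push_cast; ring]
    exact ih (h.conjSq_smul_mem i hx)

theorem eq_zero_of_span_homogeneous {ι k V W : Type*} [DecidableEq ι] [Semiring k]
    [AddCommMonoid V] [Module k V] [AddCommMonoid W] [Module k W] {𝓖 : ι → Submodule k V}
    (h : DirectSum.IsInternal 𝓖) {S : Set V} (hS : Submodule.span k S = ⊤) (φ : V →ₗ[k] W) (p : ι)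
    (hφ : ∀ x ∈ S, ∃ q, x ∈ 𝓖 q ∧ (q = p → φ x = 0)) {x : V} (hx : x ∈ 𝓖 p) : φ x = 0 := by
  let := h.chooseDecomposition
  have h_proj : φ ∘ₗ (𝓖 p).subtype ∘ₗ DirectSum.component k ι _ p ∘ₗ
      (DirectSum.decomposeLinearEquiv 𝓖).toLinearMap = 0 := by
    refine LinearMap.ext_on hS fun y hy => ?_
    obtain ⟨q, hq, hz⟩ := hφ y hy
    change φ (DirectSum.decompose 𝓖 y p) = 0
    by_cases hqp : q = p
    · subst hqp
      rw [DirectSum.decompose_of_mem_same 𝓖 hq, hz rfl]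
    · rw [DirectSum.decompose_of_mem_ne 𝓖 hq hqp, map_zero]
  have h_apply : φ (DirectSum.decompose 𝓖 x p) = 0 := LinearMap.congr_fun h_proj x
  rwa [DirectSum.decompose_of_mem_same 𝓖 hx] at h_apply

theorem span_monomial_smul [IsScalarTower (ZMod 2) SteenrodAlgebra M] {J : Type*}
    (b : Module.Basis J SteenrodAlgebra M) :
    Submodule.span (ZMod 2) {x | ∃ n a j, IsMonomial n a ∧ x = a • b j} = ⊤ := by
  have h_set : {x | ∃ n a j, IsMonomial n a ∧ x = a • b j} =
      {a | ∃ n, IsMonomial n a} • Set.range b := by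
    ext x
    simp only [Set.mem_smul, Set.mem_ofPred_eq, Set.exists_range_iff]
    exact ⟨fun ⟨n, a, j, ha, hx⟩ => ⟨a, ⟨n, ha⟩, j, hx.symm⟩,
      fun ⟨a, ⟨n, ha⟩, j, hx⟩ => ⟨n, a, j, ha, hx.symm⟩⟩
  rw [h_set, Submodule.span_smul_of_span_eq_top span_isMonomial, b.span_eq,
    Submodule.restrictScalars_top]

theorem coord_eq_zero_of_mem {ι k V K : Type*} [DecidableEq ι] [Semiring k] [AddCommMonoid V]
    [Module k V] {𝓖 : ι → Submodule k V} (h : DirectSum.IsInternal 𝓖) {e : Module.Basis K k V}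
    {deg : K → ι} (he : ∀ l, e l ∈ 𝓖 (deg l)) {l : K} {p : ι} (hp : deg l ≠ p) {m : V}
    (hm : m ∈ 𝓖 p) : e.coord l m = 0 := by
  refine eq_zero_of_span_homogeneous h e.span_eq (e.coord l) p ?_ hm
  rintro _ ⟨l', rfl⟩
  refine ⟨deg l', he l', fun hl => ?_⟩
  have hne : l' ≠ l := by
    rintro rfl
    exact hp hl
  simp [Module.Basis.coord_apply, hne]

end Monomials

/-! ### The dual bases of `Hom_A(F_s, 𝔽₂)` and `Hom_A(M ⊗ F_s, 𝔽₂)` -/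

section DualFamily

variable {k V I : Type*} [Ring k] [AddCommGroup V] [Module k V] [Finite I]
  (ev : V →ₗ[k] I → k) (f : I → V)

theorem bijective_of_apply_eq_basisFun (hev : Function.Injective ev)
    (hf : ∀ i, ev (f i) = Pi.basisFun k I i) : Function.Bijective ev := by
  refine ⟨hev, ?_⟩
  rw [← LinearMap.range_eq_top, eq_top_iff, ← (Pi.basisFun k I).span_eq, Submodule.span_le]
  rintro _ ⟨i, rfl⟩
  exact ⟨f i, hf i⟩

/-- The basis `f` of a space whose elements are determined by their values `ev`, when the values
of the members of `f` are the unit vectors. -/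
noncomputable def dualBasisOfEval (hev : Function.Injective ev)
    (hf : ∀ i, ev (f i) = Pi.basisFun k I i) : Module.Basis I k V :=
  .ofEquivFun (.ofBijective ev (bijective_of_apply_eq_basisFun ev f hev hf))

theorem dualBasisOfEval_repr (hev : Function.Injective ev)
    (hf : ∀ i, ev (f i) = Pi.basisFun k I i) (x : V) (i : I) :
    (dualBasisOfEval ev f hev hf).repr x i = ev x i := rfl

theorem dualBasisOfEval_apply (hev : Function.Injective ev)
    (hf : ∀ i, ev (f i) = Pi.basisFun k I i) (i : I) : dualBasisOfEval ev f hev hf i = f i := by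
  classical
  rw [dualBasisOfEval, Module.Basis.coe_ofEquivFun, LinearEquiv.symm_apply_eq,
    LinearEquiv.ofBijective_apply, hf, Pi.basisFun_apply]

end DualFamily

section TensorAction

variable {M : Type*} [AddCommGroup M] [Module (ZMod 2) M] [Module SteenrodAlgebra M]
  [IsScalarTower (ZMod 2) SteenrodAlgebra M] {N : Type*} [AddCommGroup N] [Module (ZMod 2) N]
  [Module SteenrodAlgebra N] [IsScalarTower (ZMod 2) SteenrodAlgebra N]

theorem sqTensor_tmul (i : ℕ) (m : M) (x : N) :
    sqTensor M N i (m ⊗ₜ x) =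
      ∑ p ∈ Finset.HasAntidiagonal.antidiagonal i, (Sq p.1 • m) ⊗ₜ[ZMod 2] (Sq p.2 • x) := by
  simp [sqTensor, sqEnd]

variable {φ : Module.Dual (ZMod 2) (M ⊗[ZMod 2] N)}

theorem apply_tmul_Sq_smul (hφ : ∀ i, 0 < i → ∀ x, φ (sqTensor M N i x) = 0) (i : ℕ) (m : M)
    (x : N) : φ (m ⊗ₜ (Sq i • x)) = φ ((conjSq i • m) ⊗ₜ x) := by
  induction i using Nat.strong_induction_on generalizing m x with
  | _ i ih =>
    rcases Nat.eq_zero_or_pos i with rfl | hi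
    · rw [Sq_zero, conjSq_zero, one_smul, one_smul]
    have h_cartan := hφ i hi (m ⊗ₜ x)
    rw [sqTensor_tmul, map_sum] at h_cartan
    have h_antipode : ∑ p ∈ Finset.HasAntidiagonal.antidiagonal i,
        φ ((conjSq p.2 • Sq p.1 • m) ⊗ₜ[ZMod 2] x) = 0 := by
      rw [← map_sum, ← TensorProduct.sum_tmul, ← Finset.Nat.sum_antidiagonal_swap]
      simp only [Prod.fst_swap, Prod.snd_swap, ← mul_smul]
      rw [← Finset.sum_smul, sum_conjSq_mul_Sq hi, zero_smul, TensorProduct.zero_tmul, map_zero]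
    have h_sub := sub_eq_zero.2 (h_cartan.trans h_antipode.symm)
    rw [← Finset.sum_sub_distrib, Finset.sum_eq_single (0, i)] at h_sub
    · simpa only [Sq_zero, one_smul, sub_eq_zero] using h_sub
    · rintro ⟨p, q⟩ hp hne
      simp only [Finset.HasAntidiagonal.mem_antidiagonal] at hp
      have hq : q < i := by
        by_contra hq
        exact hne (by simp only [Prod.mk.injEq]; omega)
      exact sub_eq_zero.2 (ih q hq _ _)
    · simp

theorem apply_tmul_smul (hφ : ∀ i, 0 < i → ∀ x, φ (sqTensor M N i x) = 0) (a : SteenrodAlgebra)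
    (m : M) (x : N) : φ (m ⊗ₜ (a • x)) = φ ((conj a • m) ⊗ₜ x) := by
  have h_mono : ∀ n a, IsMonomial n a → ∀ m x, φ (m ⊗ₜ (a • x)) = φ ((conj a • m) ⊗ₜ x) := by
    intro n a ha
    induction ha with
    | one => simp [conj_one]
    | @sq_mul i _ a _ ih =>
      intro m x
      rw [mul_smul, apply_tmul_Sq_smul hφ, ih, conj_mul, conj_Sq, mul_smul]
  have ha : a ∈ Submodule.span (ZMod 2) {a | ∃ n, IsMonomial n a} :=
    span_isMonomial ▸ Submodule.mem_top
  induction ha using Submodule.span_induction with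
  | mem a ha => exact h_mono _ a ha.choose_spec m x
  | zero => simp
  | add a b _ _ ha hb =>
    rw [add_smul, TensorProduct.tmul_add, map_add, ha, hb, map_add conj, add_smul,
      TensorProduct.add_tmul, map_add]
  | smul c a _ ha =>
    rw [smul_assoc, TensorProduct.tmul_smul, map_smul, ha, map_smul conj, smul_assoc,
      ← TensorProduct.smul_tmul' c, map_smul]

end TensorAction

namespace FreeResolution

variable (R : FreeResolution.{v, w})

section Hom

variable (n : ℤ) (s : ℕ)

instance finite_homIndex : Finite (R.HomIndex n s) := (R.finite_type s n).to_subtype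

/-- The coordinate functional of `r*_j`, as an `𝔽₂`-linear map. -/
noncomputable def coeffMap (j : R.J s) : R.F s →ₗ[ZMod 2] SteenrodAlgebra :=
  ((R.basis s).coord j).restrictScalars (ZMod 2)

theorem coeffMap_smul (j : R.J s) (a : SteenrodAlgebra) (x : R.F s) :
    R.coeffMap s j (a • x) = a * R.coeffMap s j x :=
  map_smul ((R.basis s).coord j) a x

theorem coeffMap_basis (j l : R.J s) :
    R.coeffMap s j (R.basis s l) = if l = j then 1 else 0 := by
  simp [coeffMap, Finsupp.single_apply]

/-- The functional `r_j` on `F_s` dual to `r*_j`. -/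
noncomputable def homFunctional (j : R.J s) : Module.Dual (ZMod 2) (R.F s) :=
  augmentation.toLinearMap ∘ₗ R.coeffMap s j

theorem homFunctional_smul (j : R.J s) (a : SteenrodAlgebra) (x : R.F s) :
    R.homFunctional s j (a • x) = augmentation a * R.homFunctional s j x := by
  simp [homFunctional, coeffMap_smul]

theorem homFunctional_basis (j l : R.J s) :
    R.homFunctional s j (R.basis s l) = if l = j then 1 else 0 := by
  simp [homFunctional, coeffMap_basis, apply_ite]

theorem homFunctional_mem (j : R.J s) : R.homFunctional s j ∈ R.hom (R.deg s j) s := by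
  refine ⟨fun i hi x => ?_, fun p hp x hx => ?_⟩
  · exact (R.homFunctional_smul s j (Sq i) x).trans (by rw [augmentation_Sq hi, zero_mul])
  · refine eq_zero_of_span_homogeneous (R.isGraded s).isInternal
      (span_monomial_smul (R.basis s)) (R.homFunctional s j) p ?_ hx
    rintro _ ⟨n, a, l, ha, rfl⟩
    refine ⟨_, ha.smul_mem (R.isGraded s) (R.basis_mem s l), fun hq => ?_⟩
    rw [homFunctional_smul, homFunctional_basis]
    split_ifs with hl
    · subst hl
      rw [ha.augmentation_eq_zero (by omega), zero_mul]
    · rw [mul_zero]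

/-- Evaluation of the functionals in `Hom_A(F_s, 𝔽₂)` at the basis elements `r*_j`. -/
noncomputable def homEval : R.hom n s →ₗ[ZMod 2] (R.HomIndex n s → ZMod 2) where
  toFun φ j := φ.1 (R.basis s j.1)
  map_add' _ _ := rfl
  map_smul' _ _ := rfl

theorem homEval_injective : Function.Injective (R.homEval n s) := by
  rw [injective_iff_map_eq_zero]
  intro φ hφ
  have h_basis : ∀ j, φ.1 (R.basis s j) = 0 := by
    intro j
    by_cases hj : R.deg s j = n
    · exact congrFun hφ ⟨j, hj⟩
    · exact φ.2.2 _ hj _ (R.basis_mem s j)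
  refine Subtype.ext (LinearMap.ext_on (span_monomial_smul (R.basis s)) ?_)
  rintro _ ⟨n, a, j, ha, rfl⟩
  change φ.1 _ = 0
  induction ha with
  | one => rw [one_smul, h_basis]
  | @sq_mul i _ a _ ih =>
    rcases Nat.eq_zero_or_pos i with rfl | hi
    · rwa [Sq_zero, one_mul]
    · rw [mul_smul]
      exact φ.2.1 i hi _

/-- The functional `r_j` as an element of `Hom_A(F_s, 𝔽₂)`. -/
noncomputable def homElement (j : R.HomIndex n s) : R.hom n s :=
  ⟨R.homFunctional s j.1, by simpa only [j.2] using R.homFunctional_mem s j.1⟩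

theorem homEval_homElement (j : R.HomIndex n s) :
    R.homEval n s (R.homElement n s j) = Pi.basisFun (ZMod 2) _ j := by
  ext l
  exact (R.homFunctional_basis s j.1 l.1).trans (by
    simp [Pi.single_apply, Subtype.ext_iff])

/-- The basis `r_j` of `Hom_A(F_s, 𝔽₂)` in internal degree `n`. -/
noncomputable def homBasis : Module.Basis (R.HomIndex n s) (ZMod 2) (R.hom n s) :=
  dualBasisOfEval (R.homEval n s) (R.homElement n s) (R.homEval_injective n s)
    (R.homEval_homElement n s)

theorem homBasis_repr (φ : R.hom n s) (j : R.HomIndex n s) :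
    (R.homBasis n s).repr φ j = φ.1 (R.basis s j.1) :=
  dualBasisOfEval_repr ..

theorem isDualHomBasis_homBasis : R.IsDualHomBasis R.homBasis := by
  intro n s j l
  rw [homBasis, dualBasisOfEval_apply]
  change (_ → R.homFunctional s j.1 _ = 1) ∧ (_ → R.homFunctional s j.1 _ = 0)
  rw [homFunctional_basis]
  exact ⟨fun h => if_pos h.symm, fun h => if_neg (Ne.symm h)⟩

theorem homD_homD (φ : R.hom n s) : R.homD n (s + 1) (R.homD n s φ) = 0 := by
  ext x
  change φ.1 (R.bd s (R.bd (s + 1) x)) = 0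
  rw [(R.exact_succ s).apply_apply_eq_zero x, map_zero]

end Hom

section Cochain

variable {M : Type*} [AddCommGroup M] [Module (ZMod 2) M] [Module SteenrodAlgebra M]
  [IsScalarTower (ZMod 2) SteenrodAlgebra M] {𝓜 : ℤ → Submodule (ZMod 2) M}
  {K : Type*} (e : Module.Basis K (ZMod 2) M) {degM : K → ℤ} (t : ℤ) (s : ℕ)

/-- The functional `e_k ⊗ r_j` on `M ⊗ F_s`: `m ⊗ f ↦ e_k (χ(f_j) m)`. Untwisting by the antipode
`χ` identifies the diagonal action on `M ⊗ F_s` with the action on the free factor alone. -/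
noncomputable def cochainFunctional (k : K) (j : R.J s) :
    Module.Dual (ZMod 2) (M ⊗[ZMod 2] R.F s) :=
  TensorProduct.lift (((Algebra.lsmul (ZMod 2) (ZMod 2) M).toLinearMap ∘ₗ conj ∘ₗ
    R.coeffMap s j).flip.compr₂ (e.coord k))

theorem cochainFunctional_tmul (k : K) (j : R.J s) (m : M) (f : R.F s) :
    R.cochainFunctional e s k j (m ⊗ₜ f) = e.coord k (conj (R.coeffMap s j f) • m) := rfl

theorem cochainFunctional_tmul_smul_basis (k : K) (j l : R.J s) (m : M) (a : SteenrodAlgebra) :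
    R.cochainFunctional e s k j (m ⊗ₜ (a • R.basis s l)) =
      if l = j then e.coord k (conj a • m) else 0 := by
  rw [cochainFunctional_tmul, coeffMap_smul, coeffMap_basis]
  split_ifs <;> simp

theorem cochainFunctional_basis [DecidableEq K] (k k' : K) (j j' : R.J s) :
    R.cochainFunctional e s k j (e k' ⊗ₜ R.basis s j') = if j' = j ∧ k' = k then 1 else 0 := by
  rw [← one_smul SteenrodAlgebra (R.basis s j'), cochainFunctional_tmul_smul_basis, conj_one,
    one_smul, ite_and]
  simp [Finsupp.single_apply]

theorem cochainFunctional_sqTensor (k : K) (j : R.J s) {i : ℕ} (hi : 0 < i)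
    (x : M ⊗[ZMod 2] R.F s) : R.cochainFunctional e s k j (sqTensor M (R.F s) i x) = 0 := by
  induction x using TensorProduct.induction_on with
  | zero => simp
  | add x y hx hy => rw [map_add, map_add, hx, hy, add_zero]
  | tmul m f =>
    rw [sqTensor_tmul, map_sum]
    simp only [cochainFunctional_tmul, coeffMap_smul, conj_mul, conj_Sq]
    rw [← map_sum]
    simp only [← mul_smul, mul_assoc]
    rw [← Finset.sum_smul, ← Finset.mul_sum, ← Finset.Nat.sum_antidiagonal_swap]
    simp only [Prod.fst_swap, Prod.snd_swap]
    rw [sum_conjSq_mul_Sq hi, mul_zero, zero_smul, map_zero]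

theorem cochainFunctional_mem (h𝓜 : IsGradedModule 𝓜) (he : ∀ k, e k ∈ 𝓜 (degM k)) (k : K)
    (j : R.J s) : R.cochainFunctional e s k j ∈ R.cochain 𝓜 (degM k + R.deg s j) s := by
  refine ⟨fun i hi => R.cochainFunctional_sqTensor e s k j hi, fun p q hpq m hm f hf => ?_⟩
  refine eq_zero_of_span_homogeneous (R.isGraded s).isInternal (span_monomial_smul (R.basis s))
    (R.cochainFunctional e s k j ∘ₗ TensorProduct.mk (ZMod 2) M (R.F s) m) q ?_ hf
  rintro _ ⟨n, a, l, ha, rfl⟩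
  refine ⟨_, ha.smul_mem (R.isGraded s) (R.basis_mem s l), fun hq => ?_⟩
  refine (R.cochainFunctional_tmul_smul_basis e s k j l m a).trans ?_
  split_ifs with hl
  · subst hl
    exact coord_eq_zero_of_mem h𝓜.isInternal he (by omega) (ha.conj_smul_mem h𝓜 hm)
  · rfl

instance finite_index [Finite K] : Finite (R.Index degM t s) :=
  Finite.of_surjective (α := Σ k, R.HomIndex (t - degM k) s)
    (fun x => ⟨toLex (x.1, x.2.1), add_eq_of_eq_sub' x.2.2⟩)
    fun p => ⟨⟨(ofLex p.1).1, (ofLex p.1).2, eq_sub_of_add_eq' p.2⟩, rfl⟩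

variable {R s t} in
theorem cochain_apply_eq_zero (he : ∀ k, e k ∈ 𝓜 (degM k)) {φ : R.cochain 𝓜 t s} {k : K}
    (hφ : ∀ p : R.Index degM t s, (ofLex p.1).1 = k →
      φ.1 (e (ofLex p.1).1 ⊗ₜ R.basis s (ofLex p.1).2) = 0) (j : R.J s) :
    φ.1 (e k ⊗ₜ R.basis s j) = 0 := by
  by_cases h : degM k + R.deg s j = t
  · exact hφ ⟨toLex (k, j), h⟩ rfl
  · exact φ.2.2 _ _ h _ (he k) _ (R.basis_mem s j)

variable (𝓜 degM) in
/-- Evaluation of the functionals in `Hom_A(M ⊗ F_s, 𝔽₂)` at the elements `e*_k ⊗ r*_j`. -/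
noncomputable def cochainEval : R.cochain 𝓜 t s →ₗ[ZMod 2] (R.Index degM t s → ZMod 2) where
  toFun φ p := φ.1 (e (ofLex p.1).1 ⊗ₜ R.basis s (ofLex p.1).2)
  map_add' _ _ := rfl
  map_smul' _ _ := rfl

theorem cochainEval_injective (he : ∀ k, e k ∈ 𝓜 (degM k)) :
    Function.Injective (R.cochainEval 𝓜 e degM t s) := by
  rw [injective_iff_map_eq_zero]
  intro φ hφ
  have h_basis : ∀ m j, φ.1 (m ⊗ₜ R.basis s j) = 0 := by
    intro m j
    have h_lin : φ.1 ∘ₗ (TensorProduct.mk (ZMod 2) M (R.F s)).flip (R.basis s j) = 0 :=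
      e.ext fun k => cochain_apply_eq_zero e he (fun p _ => congrFun hφ p) j
    exact LinearMap.congr_fun h_lin m
  refine Subtype.ext (TensorProduct.ext' fun m f => ?_)
  have h_lin : φ.1 ∘ₗ TensorProduct.mk (ZMod 2) M (R.F s) m = 0 := by
    refine LinearMap.ext_on (span_monomial_smul (R.basis s)) ?_
    rintro _ ⟨n, a, j, -, rfl⟩
    exact (apply_tmul_smul φ.2.1 a m _).trans (h_basis _ j)
  exact LinearMap.congr_fun h_lin f

variable (h𝓜 : IsGradedModule 𝓜) (he : ∀ k, e k ∈ 𝓜 (degM k))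

/-- The functional `e_k ⊗ r_j` as an element of `Hom_A(M ⊗ F_s, 𝔽₂)`. -/
noncomputable def cochainElement (p : R.Index degM t s) : R.cochain 𝓜 t s :=
  ⟨R.cochainFunctional e s (ofLex p.1).1 (ofLex p.1).2,
    by simpa only [p.2] using R.cochainFunctional_mem e s h𝓜 he (ofLex p.1).1 (ofLex p.1).2⟩

variable [Finite K]

theorem cochainEval_cochainElement (p : R.Index degM t s) :
    R.cochainEval 𝓜 e degM t s (R.cochainElement e t s h𝓜 he p) =
      Pi.basisFun (ZMod 2) _ p := by
  classical
  ext q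
  refine (R.cochainFunctional_basis e s (ofLex p.1).1 (ofLex q.1).1 (ofLex p.1).2
    (ofLex q.1).2).trans ?_
  have h_iff : (ofLex q.1).2 = (ofLex p.1).2 ∧ (ofLex q.1).1 = (ofLex p.1).1 ↔ q = p :=
    and_comm.trans (Prod.ext_iff.symm.trans (ofLex.injective.eq_iff.trans Subtype.ext_iff.symm))
  rw [Pi.basisFun_apply, Pi.single_apply, if_congr h_iff rfl rfl]

/-- The basis `e_k ⊗ r_j` of `Hom_A(M ⊗ F_s, 𝔽₂)` in internal degree `t`. -/
noncomputable def cochainBasis :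
    Module.Basis (R.Index degM t s) (ZMod 2) ((R.ahComplex 𝓜 t).X s) :=
  dualBasisOfEval (R.cochainEval 𝓜 e degM t s) (R.cochainElement e t s h𝓜 he)
    (R.cochainEval_injective e t s he) (R.cochainEval_cochainElement e t s h𝓜 he)

theorem isDualBasis_cochainBasis :
    R.IsDualBasis 𝓜 e degM (fun t s => R.cochainBasis e t s h𝓜 he) := by
  classical
  intro t s p k' j'
  have h_apply : R.cochainBasis e t s h𝓜 he p = R.cochainElement e t s h𝓜 he p :=
    dualBasisOfEval_apply ..
  rw [h_apply]
  change (_ → R.cochainFunctional e s _ _ _ = 1) ∧ (_ → R.cochainFunctional e s _ _ _ = 0)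
  rw [cochainFunctional_basis]
  refine ⟨fun h => if_pos (by simp [h]), fun h => if_neg fun ⟨hj, hk⟩ => h ?_⟩
  rw [hj, hk]

theorem cochainBasis_repr (φ : R.cochain 𝓜 t s) (p : R.Index degM t s) :
    (R.cochainBasis e t s h𝓜 he).repr φ p =
      φ.1 (e (ofLex p.1).1 ⊗ₜ R.basis s (ofLex p.1).2) :=
  dualBasisOfEval_repr ..

theorem mem_fil_iff (n : ℤ) (φ : (R.ahComplex 𝓜 t).X s) :
    φ ∈ (R.ahComplex 𝓜 t).fil n s ↔ ∀ p : R.Index degM t s, n < R.wt degM t s p →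
      (R.cochainBasis e t s h𝓜 he).repr φ p = 0 := by
  refine ⟨fun h p hp => h _ hp _ (he _) _, fun h q hq m hm f => ?_⟩
  change R.cochain 𝓜 t s at φ
  have h_basis : ∀ l, n < l → ∀ m ∈ 𝓜 l, ∀ j, φ.1 (m ⊗ₜ R.basis s j) = 0 := by
    intro l hl m hm j
    refine eq_zero_of_span_homogeneous h𝓜.isInternal e.span_eq
      (φ.1 ∘ₗ (TensorProduct.mk (ZMod 2) M (R.F s)).flip (R.basis s j)) l ?_ hm
    rintro _ ⟨k, rfl⟩
    refine ⟨degM k, he k, fun hk => cochain_apply_eq_zero e he (fun p hp => h p ?_) j⟩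
    rwa [wt, hp, hk]
  have h_lin : φ.1 ∘ₗ TensorProduct.mk (ZMod 2) M (R.F s) m = 0 := by
    refine LinearMap.ext_on (span_monomial_smul (R.basis s)) ?_
    rintro _ ⟨i, a, j, ha, rfl⟩
    exact (apply_tmul_smul φ.2.1 a m _).trans
      (h_basis _ (by omega) _ (ha.conj_smul_mem h𝓜 hm) j)
  exact LinearMap.congr_fun h_lin f

end Cochain

end FreeResolution

/-! ### Leading terms and triangular families -/

section Leading

variable {X I : Type*} [AddCommMonoid X] [Module (ZMod 2) X] [LinearOrder I]
  {b : Module.Basis I (ZMod 2) X} {x y : X} {i j : I}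

theorem IsLeading.unique (hi : IsLeading b x i) (hj : IsLeading b x j) : i = j := by
  rcases lt_trichotomy i j with h | h | h
  · exact absurd (hi.2 j h) hj.1
  · exact h
  · exact absurd (hj.2 i h) hi.1

theorem exists_isLeading (b : Module.Basis I (ZMod 2) X) (hx : x ≠ 0) :
    ∃ i, IsLeading b x i := by
  have h_ne : (b.repr x).support.Nonempty := by simpa using hx
  refine ⟨_, Finsupp.mem_support_iff.1 (Finset.max'_mem _ h_ne), fun j hj => ?_⟩
  by_contra hj0
  exact (Finset.le_max' _ j (Finsupp.mem_support_iff.2 hj0)).not_gt hj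

theorem IsLeading.ne_zero (h : IsLeading b x i) : x ≠ 0 := by
  rintro rfl
  exact h.1 (by simp)

theorem isLeading_self (b : Module.Basis I (ZMod 2) X) (i : I) : IsLeading b (b i) i :=
  ⟨by simp, fun j hj => by simp [hj.ne]⟩

theorem IsLeading.repr_eq_one (h : IsLeading b x i) : b.repr x i = 1 :=
  Fin.eq_one_of_ne_zero _ h.1

theorem IsLeading.le_of_repr_ne_zero (h : IsLeading b x i) (hj : b.repr x j ≠ 0) : j ≤ i :=
  not_lt.1 fun hij => hj (h.2 j hij)

theorem IsLeading.add_of_lt (hx : IsLeading b x i) (hy : IsLeading b y j) (hij : i < j) :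
    IsLeading b (x + y) j := by
  refine ⟨by simpa [hx.2 j hij] using hy.1, fun l hl => ?_⟩
  simp [hx.2 l (hij.trans hl), hy.2 l hl]

theorem IsLeading.lt_of_isLeading_add (hx : IsLeading b x i) (hy : IsLeading b y i)
    (hj : IsLeading b (x + y) j) : j < i := by
  refine lt_of_not_ge fun hij => hj.1 ?_
  rcases hij.eq_or_lt with rfl | hij
  · rw [map_add, Finsupp.add_apply, hx.repr_eq_one, hy.repr_eq_one]
    rfl
  · simp [hx.2 j hij, hy.2 j hij]

variable {g : I → X}

theorem isLeading_linearCombination (hg : ∀ i, IsLeading b (g i) i) {c : I →₀ ZMod 2}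
    (hi : c i ≠ 0) (hc : ∀ j, i < j → c j = 0) :
    IsLeading b (Finsupp.linearCombination (ZMod 2) g c) i := by
  have h_repr (l : I) : b.repr (Finsupp.linearCombination (ZMod 2) g c) l =
      c.sum fun j a => a * b.repr (g j) l := by
    simp [Finsupp.linearCombination_apply, Finsupp.sum, Finset.sum_apply']
  have h_zero {l j : I} (hl : i ≤ l) (hj : j ≠ i ∨ i < l) : c j * b.repr (g j) l = 0 := by
    rcases lt_or_ge i j with hij | hij
    · rw [hc j hij, zero_mul]
    · rw [(hg j).2 l (by grind), mul_zero]
  refine ⟨?_, fun l hl => ?_⟩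
  · rw [h_repr, Finsupp.sum, Finset.sum_eq_single i (fun j _ hj => h_zero le_rfl (.inl hj))
      (fun h => by simp [Finsupp.notMem_support_iff.1 h])]
    exact mul_ne_zero hi (hg i).1
  · exact (h_repr l).trans (Finset.sum_eq_zero fun j _ => h_zero hl.le (.inr hl))

theorem isLeading_iff_of_isLeading {g : Module.Basis I (ZMod 2) X}
    (hg : ∀ i, IsLeading b (g i) i) : IsLeading g x i ↔ IsLeading b x i := by
  have h_imp {i : I} (hi : IsLeading g x i) : IsLeading b x i :=
    g.linearCombination_repr x ▸ isLeading_linearCombination hg hi.1 hi.2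
  refine ⟨h_imp, fun hi => ?_⟩
  obtain ⟨j, hj⟩ := exists_isLeading g hi.ne_zero
  rwa [hi.unique (h_imp hj)]

theorem isLeading_symm {g : Module.Basis I (ZMod 2) X} (hg : ∀ i, IsLeading b (g i) i) (i : I) :
    IsLeading g (b i) i :=
  (isLeading_iff_of_isLeading hg).2 (isLeading_self b i)

end Leading

section Triangular

variable {X I : Type*} [AddCommGroup X] [Module (ZMod 2) X] [LinearOrder I]
  {b : Module.Basis I (ZMod 2) X} {g : I → X}

theorem linearIndependent_of_isLeading (hg : ∀ i, IsLeading b (g i) i) :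
    LinearIndependent (ZMod 2) g := by
  rw [linearIndependent_iff]
  intro c hc
  by_contra h_ne
  obtain ⟨i, hi⟩ := exists_isLeading Finsupp.basisSingleOne h_ne
  exact (isLeading_linearCombination hg hi.1 hi.2).ne_zero hc

theorem span_range_of_isLeading [WellFoundedLT I] (hg : ∀ i, IsLeading b (g i) i) :
    Submodule.span (ZMod 2) (Set.range g) = ⊤ := by
  rw [eq_top_iff, ← b.span_eq, Submodule.span_le]
  rintro _ ⟨i, rfl⟩
  induction i using WellFoundedLT.induction with
  | _ i ih =>
    have h_sum := b.linearCombination_repr (g i)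
    rw [Finsupp.linearCombination_apply, Finsupp.sum,
      ← Finset.add_sum_erase _ _ (Finsupp.mem_support_iff.2 (hg i).1), (hg i).repr_eq_one,
      one_smul] at h_sum
    rw [eq_sub_of_add_eq h_sum]
    refine sub_mem (Submodule.subset_span ⟨i, rfl⟩)
      (sum_mem fun j hj => Submodule.smul_mem _ _ (ih j ?_))
    have hj := Finset.mem_erase.1 hj
    exact lt_of_le_of_ne ((hg i).le_of_repr_ne_zero (Finsupp.mem_support_iff.1 hj.2)) hj.1

theorem exists_basis_of_isLeading [WellFoundedLT I] (hg : ∀ i, IsLeading b (g i) i) :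
    ∃ B : Module.Basis I (ZMod 2) X, ⇑B = g :=
  ⟨.mk (linearIndependent_of_isLeading hg) (span_range_of_isLeading hg).ge, Module.Basis.coe_mk ..⟩

end Triangular

/-! ### Matchings and Curtis tables -/

section Matching

variable {I : ℕ → Type*} {τ : ∀ s, I (s + 1) → I s → Prop} {s : ℕ}

/-- A relation between labels of adjacent degrees that pairs up some of the labels, each with a
single partner. `τ s a c` stands for the tag `a ← c`. -/
structure IsMatching (τ : ∀ s, I (s + 1) → I s → Prop) : Prop where
  head_unique : ∀ {s a a' c}, τ s a c → τ s a' c → a = a'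
  source_unique : ∀ {s a c c'}, τ s a c → τ s a c' → c = c'
  not_source : ∀ {s a a' c}, τ s a c → ¬ τ (s + 1) a' a

/-- The labels `a` of the tags `a ← c` with `c ∈ S`. -/
def heads (τ : ∀ s, I (s + 1) → I s → Prop) (S : ∀ s, Set (I s)) : ∀ s, Set (I s)
  | 0 => ∅
  | s + 1 => {a | ∃ c ∈ S s, τ s a c}

/-- The label occurs in no tag. -/
def IsFree (τ : ∀ s, I (s + 1) → I s → Prop) (s : ℕ) (i : I s) : Prop :=
  i ∉ heads τ (fun _ => Set.univ) s ∧ ∀ a, ¬ τ s a i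

/-- The list of tags of a matching, completed by the unmatched labels as untagged items. -/
def matchingTable (τ : ∀ s, I (s + 1) → I s → Prop) : Set (Item (Σ s, I s)) :=
  {it | (∃ s i, IsFree τ s i ∧ it = .untagged ⟨s, i⟩) ∨
    ∃ s a c, τ s a c ∧ it = .tag ⟨s + 1, a⟩ ⟨s, c⟩}

theorem untagged_mem_matchingTable {x : Σ s, I s} :
    .untagged x ∈ matchingTable τ ↔ IsFree τ x.1 x.2 := by
  refine ⟨?_, fun h => .inl ⟨_, _, h, rfl⟩⟩
  rintro (⟨s, i, h, hx⟩ | ⟨_, _, _, _, hx⟩)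
  · cases hx
    exact h
  · cases hx

theorem tag_mem_matchingTable {a : I (s + 1)} {c : I s} :
    .tag ⟨s + 1, a⟩ ⟨s, c⟩ ∈ matchingTable τ ↔ τ s a c := by
  refine ⟨?_, fun h => .inr ⟨_, _, _, h, rfl⟩⟩
  rintro (⟨_, _, _, hx⟩ | ⟨s, a, c, h, hx⟩)
  · cases hx
  · cases hx
    exact h

theorem mem_heads_univ {i : I s} :
    i ∈ heads τ (fun _ => Set.univ) s ↔ ∃ c, .tag ⟨s, i⟩ c ∈ matchingTable τ := by
  cases s with
  | zero =>
    refine ⟨False.elim, ?_⟩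
    rintro ⟨c, ⟨_, _, _, hx⟩ | ⟨_, _, _, _, hx⟩⟩ <;> cases hx
  | succ s =>
    refine ⟨fun ⟨c, _, h⟩ => ⟨⟨s, c⟩, tag_mem_matchingTable.2 h⟩, ?_⟩
    rintro ⟨c, ⟨_, _, _, hx⟩ | ⟨_, _, c, h, hx⟩⟩
    · cases hx
    · cases hx
      exact ⟨c, trivial, h⟩

theorem exists_head_mem_matchingTable (hτ : IsMatching τ) {x : Σ s, I s} :
    (∃ it ∈ matchingTable τ, it.head = x) ↔ ∀ a, ¬ τ x.1 a x.2 := by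
  obtain ⟨s, i⟩ := x
  constructor
  · rintro ⟨it, ⟨s, i, h, rfl⟩ | ⟨s, a, c, h, rfl⟩, hx⟩ <;> cases hx
    · exact h.2
    · exact fun a' => hτ.not_source h
  · intro h
    by_cases hi : i ∈ heads τ (fun _ => Set.univ) s
    · obtain ⟨c, hc⟩ := mem_heads_univ.1 hi
      exact ⟨_, hc, rfl⟩
    · exact ⟨_, untagged_mem_matchingTable.2 ⟨hi, h⟩, rfl⟩

theorem not_isFree_of_contains {a : I (s + 1)} {c : I s} (h : τ s a c) {x : Σ s, I s}
    (hx : (Item.tag ⟨s + 1, a⟩ ⟨s, c⟩).Contains x) : ¬ IsFree τ x.1 x.2 := by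
  rcases hx with rfl | rfl
  · exact fun h_free => h_free.1 ⟨c, trivial, h⟩
  · exact fun h_free => h_free.2 a h

theorem existsUnique_mem_matchingTable (hτ : IsMatching τ) (x : Σ s, I s) :
    ∃! it, it ∈ matchingTable τ ∧ it.Contains x := by
  refine existsUnique_of_exists_of_unique ?_ ?_
  · by_cases h : ∃ a, τ x.1 a x.2
    · obtain ⟨a, ha⟩ := h
      exact ⟨_, tag_mem_matchingTable.2 ha, .inr rfl⟩
    · obtain ⟨it, hit, rfl⟩ := (exists_head_mem_matchingTable hτ).2 (not_exists.1 h)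
      refine ⟨it, hit, ?_⟩
      cases it with
      | untagged x => exact rfl
      | tag a c => exact .inl rfl
  · rintro _ _ ⟨⟨s, i, hi, rfl⟩ | ⟨s, a, c, h, rfl⟩, hx⟩
      ⟨⟨s', i', hi', rfl⟩ | ⟨s', a', c', h', rfl⟩, hx'⟩
    · cases hx.symm.trans hx'
      rfl
    · cases hx
      exact absurd hi (not_isFree_of_contains h' hx')
    · cases hx'
      exact absurd hi' (not_isFree_of_contains h hx)
    · rcases hx with rfl | rfl <;> rcases hx' with hx' | hx' <;> cases hx'
      · rw [hτ.source_unique h h']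
      · exact absurd h' (hτ.not_source h)
      · exact absurd h (hτ.not_source h')
      · rw [hτ.head_unique h h']

theorem IsMatching.exists_family {X : ℕ → Type*} (hτ : IsMatching τ)
    (d : ∀ s, X s → X (s + 1)) (y : ∀ s, I s → X s) :
    ∃ g : ∀ s, I s → X s, (∀ s a c, τ s a c → g (s + 1) a = d s (y s c)) ∧
      ∀ s i, i ∉ heads τ (fun _ => Set.univ) s → g s i = y s i := by
  classical
  refine ⟨fun
    | 0, i => y 0 i
    | s + 1, a => if h : ∃ c, τ s a c then d s (y s h.choose) else y (s + 1) a, ?_, ?_⟩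
  · intro s a c hac
    have h : ∃ c, τ s a c := ⟨c, hac⟩
    simp only [dif_pos h, hτ.source_unique h.choose_spec hac]
  · rintro (_ | s) i hi
    · rfl
    · exact dif_neg fun ⟨c, hc⟩ => hi ⟨c, trivial, hc⟩

end Matching

section Canonical

variable {X : ℕ → Type*} [∀ s, AddCommMonoid (X s)] [∀ s, Module (ZMod 2) (X s)]
  {d : ∀ s, X s →ₗ[ZMod 2] X (s + 1)} {I : ℕ → Type*}
  {g : ∀ s, Module.Basis (I s) (ZMod 2) (X s)} {τ : ∀ s, I (s + 1) → I s → Prop} {s : ℕ}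

/-- Barannikov's normal form of a complex: the differential maps each basis element either to the
basis element matched with it or to zero. -/
structure IsCanonicalForm (d : ∀ s, X s →ₗ[ZMod 2] X (s + 1))
    (g : ∀ s, Module.Basis (I s) (ZMod 2) (X s)) (τ : ∀ s, I (s + 1) → I s → Prop) :
    Prop extends IsMatching τ where
  d_source : ∀ {s a c}, τ s a c → d s (g s c) = g (s + 1) a
  d_eq_zero : ∀ {s c}, (∀ a, ¬ τ s a c) → d s (g s c) = 0

namespace IsCanonicalForm

theorem d_d (h : IsCanonicalForm d g τ) (s : ℕ) (x : X s) : d (s + 1) (d s x) = 0 := by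
  suffices h_comp : d (s + 1) ∘ₗ d s = 0 from LinearMap.congr_fun h_comp x
  refine (g s).ext fun c => ?_
  by_cases hc : ∃ a, τ s a c
  · obtain ⟨a, ha⟩ := hc
    simpa [h.d_source ha] using h.d_eq_zero fun a' => h.not_source ha
  · simp [h.d_eq_zero (not_exists.1 hc)]

theorem repr_d (h : IsCanonicalForm d g τ) {a : I (s + 1)} {c : I s} (hac : τ s a c) (x : X s) :
    (g (s + 1)).repr (d s x) a = (g s).repr x c := by
  suffices h_comp : (g (s + 1)).coord a ∘ₗ d s = (g s).coord c from LinearMap.congr_fun h_comp x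
  refine (g s).ext fun c' => ?_
  by_cases hc' : ∃ a', τ s a' c'
  · obtain ⟨a', ha'⟩ := hc'
    have h_iff : a' = a ↔ c' = c :=
      ⟨fun h_eq => h.source_unique (h_eq ▸ ha') hac, fun h_eq => h.head_unique (h_eq ▸ ha') hac⟩
    classical
    simp [h.d_source ha', Finsupp.single_apply, h_iff]
  · have h_ne : c' ≠ c := fun h_eq => hc' ⟨a, h_eq ▸ hac⟩
    simp [h.d_eq_zero (not_exists.1 hc'), h_ne]

theorem repr_d_eq_zero (h : IsCanonicalForm d g τ) {a : I (s + 1)} (ha : ∀ c, ¬ τ s a c)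
    (x : X s) : (g (s + 1)).repr (d s x) a = 0 := by
  suffices h_comp : (g (s + 1)).coord a ∘ₗ d s = 0 from LinearMap.congr_fun h_comp x
  refine (g s).ext fun c => ?_
  by_cases hc : ∃ a', τ s a' c
  · obtain ⟨a', ha'⟩ := hc
    have h_ne : a' ≠ a := fun h_eq => ha c (h_eq ▸ ha')
    simp [h.d_source ha', h_ne]
  · simp [h.d_eq_zero (not_exists.1 hc)]

theorem d_eq_zero_iff (h : IsCanonicalForm d g τ) {x : X s} :
    d s x = 0 ↔ ∀ a c, τ s a c → (g s).repr x c = 0 := by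
  refine ⟨fun hx a c hac => by simp [← h.repr_d hac, hx], fun hx => ?_⟩
  refine (g (s + 1)).ext_elem fun a => ?_
  by_cases ha : ∃ c, τ s a c
  · obtain ⟨c, hc⟩ := ha
    simp [h.repr_d hc, hx a c hc]
  · simp [h.repr_d_eq_zero (not_exists.1 ha)]

theorem isCurtisTable [∀ s, LinearOrder (I s)] (h : IsCanonicalForm d g τ)
    {b : ∀ s, Module.Basis (I s) (ZMod 2) (X s)} (hg : ∀ s i, IsLeading (b s) (g s i) i) :
    IsCurtisTable d b (matchingTable τ) where
  degree a c hac := by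
    rcases hac with ⟨_, _, _, hx⟩ | ⟨_, _, _, _, hx⟩ <;> cases hx
    rfl
  once := existsUnique_mem_matchingTable h.toIsMatching
  head_iff x := by
    rw [exists_head_mem_matchingTable h.toIsMatching]
    refine ⟨fun hx => ⟨g x.1 x.2, h.d_eq_zero hx, hg _ _⟩, fun ⟨z, hz, hzx⟩ a ha => ?_⟩
    exact ((isLeading_iff_of_isLeading (hg x.1)).2 hzx).1 (h.d_eq_zero_iff.1 hz a _ ha)
  tag_lift s a c hac := ⟨g s c, hg s c, by
    rw [h.d_source (tag_mem_matchingTable.1 hac)]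
    exact hg _ _⟩

end IsCanonicalForm

end Canonical

section CurtisMatching

variable {X : ℕ → Type*} [∀ s, AddCommGroup (X s)] [∀ s, Module (ZMod 2) (X s)]
  {d : ∀ s, X s →ₗ[ZMod 2] X (s + 1)} {I : ℕ → Type*} [∀ s, LinearOrder (I s)]
  {b : ∀ s, Module.Basis (I s) (ZMod 2) (X s)} {τ : ∀ s, I (s + 1) → I s → Prop} {s : ℕ}
  {T : Set (Item (Σ s, I s))}

/-- A matching whose tags can be lifted to differentials, and whose other labels lead cycles. -/
structure IsCurtisMatching (d : ∀ s, X s →ₗ[ZMod 2] X (s + 1))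
    (b : ∀ s, Module.Basis (I s) (ZMod 2) (X s)) (τ : ∀ s, I (s + 1) → I s → Prop) :
    Prop extends IsMatching τ where
  exists_lift : ∀ {s a c}, τ s a c → ∃ y, IsLeading (b s) y c ∧ IsLeading (b (s + 1)) (d s y) a
  exists_cycle : ∀ {s c}, (∀ a, ¬ τ s a c) → ∃ z, d s z = 0 ∧ IsLeading (b s) z c

theorem IsCurtisMatching.exists_isLeading_family (hτ : IsCurtisMatching d b τ) :
    ∃ y : ∀ s, I s → X s, (∀ s c, IsLeading (b s) (y s c) c) ∧
      (∀ s c a, τ s a c → IsLeading (b (s + 1)) (d s (y s c)) a) ∧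
      ∀ s c, (∀ a, ¬ τ s a c) → d s (y s c) = 0 := by
  have h_exists (s : ℕ) (c : I s) : ∃ y, IsLeading (b s) y c ∧
      (∀ a, τ s a c → IsLeading (b (s + 1)) (d s y) a) ∧ ((∀ a, ¬ τ s a c) → d s y = 0) := by
    by_cases hc : ∃ a, τ s a c
    · obtain ⟨a, ha⟩ := hc
      obtain ⟨y, hy, hdy⟩ := hτ.exists_lift ha
      exact ⟨y, hy, fun a' ha' => hτ.head_unique ha ha' ▸ hdy, fun h => absurd ha (h a)⟩
    · obtain ⟨z, hz, hzc⟩ := hτ.exists_cycle (not_exists.1 hc)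
      exact ⟨z, hzc, fun a ha => absurd ⟨a, ha⟩ hc, fun _ => hz⟩
  choose y hy h_source h_cycle using h_exists
  exact ⟨y, hy, h_source, h_cycle⟩

theorem IsCurtisMatching.exists_isCanonicalForm [∀ s, WellFoundedLT (I s)]
    (hτ : IsCurtisMatching d b τ) (hdd : ∀ s x, d (s + 1) (d s x) = 0) :
    ∃ g : ∀ s, Module.Basis (I s) (ZMod 2) (X s),
      IsCanonicalForm d g τ ∧ ∀ s i, IsLeading (b s) (g s i) i := by
  obtain ⟨y, hy, h_source, h_cycle⟩ := hτ.exists_isLeading_family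
  obtain ⟨f, hf_head, hf⟩ := hτ.exists_family (fun s => d s) y
  have hf_source {s a c} (hac : τ s a c) : f s c = y s c :=
    hf s c (by cases s with
      | zero => exact False.elim
      | succ s => exact fun ⟨c', _, hc'⟩ => hτ.not_source hc' hac)
  have h_lead (s : ℕ) (i : I s) : IsLeading (b s) (f s i) i := by
    by_cases hi : i ∈ heads τ (fun _ => Set.univ) s
    · cases s with
      | zero => exact hi.elim
      | succ s =>
        obtain ⟨c, _, hc⟩ := hi
        exact hf_head s i c hc ▸ h_source s c i hc
    · exact hf s i hi ▸ hy s i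
  choose g hg using fun s => exists_basis_of_isLeading (h_lead s)
  refine ⟨g, { hτ.toIsMatching with d_source := ?_, d_eq_zero := ?_ }, fun s i => ?_⟩
  · intro s a c hac
    rw [hg, hg, hf_head s a c hac, hf_source hac]
  · intro s c hc
    rw [hg]
    by_cases hi : c ∈ heads τ (fun _ => Set.univ) s
    · cases s with
      | zero => exact hi.elim
      | succ s =>
        obtain ⟨c', _, hc'⟩ := hi
        rw [hf_head s c c' hc', hdd]
    · rw [hf s c hi, h_cycle s c hc]
  · rw [hg]
    exact h_lead s i

/-- The labels of the elements whose boundary has leading term `a`. -/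
def boundarySources (d : ∀ s, X s →ₗ[ZMod 2] X (s + 1))
    (b : ∀ s, Module.Basis (I s) (ZMod 2) (X s)) (s : ℕ) (a : I (s + 1)) : Set (I s) :=
  {c | ∃ y, IsLeading (b s) y c ∧ IsLeading (b (s + 1)) (d s y) a}

theorem exists_isLeast_boundarySources [WellFoundedLT (I s)] {a : I (s + 1)}
    (h : (boundarySources d b s a).Nonempty) : ∃ c, IsLeast (boundarySources d b s a) c :=
  ⟨_, WellFounded.min_mem wellFounded_lt _ h, fun _ hc => WellFounded.min_le wellFounded_lt hc⟩

theorem IsCurtisMatching.iff_isLeast [∀ s, WellFoundedLT (I s)]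
    (hτ : IsCurtisMatching d b τ) (hdd : ∀ s x, d (s + 1) (d s x) = 0) {a : I (s + 1)} {c : I s} :
    τ s a c ↔ IsLeast (boundarySources d b s a) c := by
  obtain ⟨g, hg, h_lead⟩ := hτ.exists_isCanonicalForm hdd
  have h_least {c : I s} (hac : τ s a c) : IsLeast (boundarySources d b s a) c := by
    refine ⟨hτ.exists_lift hac, fun c' ⟨y, hy, hdy⟩ => ?_⟩
    have hdy' := ((isLeading_iff_of_isLeading (h_lead (s + 1))).2 hdy).1
    rw [hg.repr_d hac] at hdy'
    exact ((isLeading_iff_of_isLeading (h_lead s)).2 hy).le_of_repr_ne_zero hdy'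
  refine ⟨h_least, fun hc => ?_⟩
  obtain ⟨y, -, hdy⟩ := hc.1
  have hdy' := ((isLeading_iff_of_isLeading (h_lead (s + 1))).2 hdy).1
  obtain ⟨c', hc'⟩ : ∃ c', τ s a c' := by
    by_contra! ha
    exact hdy' (hg.repr_d_eq_zero ha y)
  rwa [hc.unique (h_least hc')]

theorem exists_lt_mem_boundarySources {a : I (s + 1)} {c : I s} {x y : X s}
    (hx : IsLeading (b s) x c) (hy : IsLeading (b s) y c)
    (h_lead : IsLeading (b (s + 1)) (d s (x + y)) a) : ∃ c' ∈ boundarySources d b s a, c' < c := by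
  have h_ne : x + y ≠ 0 := fun h_zero => h_lead.ne_zero (by rw [h_zero, map_zero])
  obtain ⟨c', hc'⟩ := exists_isLeading (b s) h_ne
  exact ⟨c', ⟨_, hc', h_lead⟩, hx.lt_of_isLeading_add hy hc'⟩

theorem isMatching_isLeast (hdd : ∀ s x, d (s + 1) (d s x) = 0) :
    IsMatching fun s a c => IsLeast (boundarySources d b s a) c where
  head_unique {s a a' c} h h' := by
    wlog h_lt : a < a' generalizing a a'
    · rcases (not_lt.1 h_lt).eq_or_lt with h_eq | h_lt
      · exact h_eq.symm
      · exact (this h' h h_lt).symm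
    obtain ⟨y, hy, hdy⟩ := h.1
    obtain ⟨y', hy', hdy'⟩ := h'.1
    obtain ⟨c', hc', h_c'⟩ := exists_lt_mem_boundarySources (d := d) hy hy'
      (map_add (d s) y y' ▸ hdy.add_of_lt hdy' h_lt)
    exact absurd (h'.2 hc') h_c'.not_ge
  source_unique h h' := h.unique h'
  not_source {s a a' c} h h' := by
    obtain ⟨y, -, hdy⟩ := h.1
    obtain ⟨x, hx, hdx⟩ := h'.1
    obtain ⟨c', hc', h_c'⟩ := exists_lt_mem_boundarySources (d := d) hx hdy
      (by rwa [map_add, hdd, add_zero])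
    exact absurd (h'.2 hc') h_c'.not_ge

theorem exists_isLeast_or_exists_cycle [WellFoundedLT (I (s + 1))] (c : I s) :
    (∃ a, IsLeast (boundarySources d b s a) c) ∨ ∃ z, d s z = 0 ∧ IsLeading (b s) z c := by
  by_contra! h
  obtain ⟨h_least, h_cycle⟩ := h
  have h_source : {a | c ∈ boundarySources d b s a}.Nonempty := by
    obtain ⟨a, ha⟩ := exists_isLeading (b (s + 1)) fun h0 => h_cycle _ h0 (isLeading_self _ c)
    exact ⟨a, b s c, isLeading_self _ c, ha⟩
  obtain ⟨a, ⟨y, hy, hdy⟩, h_min⟩ := WellFounded.has_min wellFounded_lt _ h_source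
  refine h_least a ⟨⟨y, hy, hdy⟩, fun c' ⟨y', hy', hdy'⟩ => le_of_not_gt fun h_lt => ?_⟩
  have h_add : IsLeading (b s) (y' + y) c := hy'.add_of_lt hy h_lt
  obtain ⟨a', ha'⟩ := exists_isLeading (b (s + 1)) fun h0 => h_cycle _ h0 h_add
  refine h_min a' ⟨_, h_add, ha'⟩ (hdy'.lt_of_isLeading_add hdy ?_)
  rwa [← map_add]

theorem isCurtisMatching_isLeast [∀ s, WellFoundedLT (I s)]
    (hdd : ∀ s x, d (s + 1) (d s x) = 0) :
    IsCurtisMatching d b fun s a c => IsLeast (boundarySources d b s a) c where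
  toIsMatching := isMatching_isLeast hdd
  exists_lift h := h.1
  exists_cycle h := (exists_isLeast_or_exists_cycle _).resolve_left (not_exists.2 h)

theorem IsCurtisTable.eq_of_contains (hT : IsCurtisTable d b T) {it it' : Item (Σ s, I s)}
    (hit : it ∈ T) (hit' : it' ∈ T) {x : Σ s, I s} (hx : it.Contains x) (hx' : it'.Contains x) :
    it = it' :=
  (hT.once x).unique ⟨hit, hx⟩ ⟨hit', hx'⟩

theorem IsCurtisTable.untagged_mem_iff_forall_not_contains (hT : IsCurtisTable d b T)
    {x : Σ s, I s} :
    .untagged x ∈ T ↔ ∀ a c, .tag a c ∈ T → ¬ (Item.tag a c).Contains x := by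
  constructor
  · intro h a c hac hx
    cases hT.eq_of_contains h hac rfl hx
  · intro h
    obtain ⟨it, hit, hx⟩ := (hT.once x).exists
    cases it with
    | untagged y => exact hx ▸ hit
    | tag a c => exact absurd hx (h a c hit)

/-- The tags of a list of items, as a relation between labels of adjacent degrees. -/
def tagRel (T : Set (Item (Σ s, I s))) (s : ℕ) (a : I (s + 1)) (c : I s) : Prop :=
  .tag ⟨s + 1, a⟩ ⟨s, c⟩ ∈ T

theorem IsCurtisTable.isCurtisMatching (hT : IsCurtisTable d b T) :
    IsCurtisMatching d b (tagRel T) where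
  head_unique h h' := by
    cases hT.eq_of_contains h h' (.inr rfl) (.inr rfl)
    rfl
  source_unique h h' := by
    cases hT.eq_of_contains h h' (.inl rfl) (.inl rfl)
    rfl
  not_source h h' := by
    cases hT.eq_of_contains h h' (.inl rfl) (.inr rfl)
  exists_lift h := hT.tag_lift _ _ _ h
  exists_cycle {s c} h := by
    obtain ⟨it, hit, hx⟩ := (hT.once ⟨s, c⟩).exists
    refine (hT.head_iff ⟨s, c⟩).1 ⟨it, hit, ?_⟩
    cases it with
    | untagged x => exact hx.symm
    | tag a c =>
      refine (hx.resolve_right ?_).symm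
      rintro rfl
      obtain ⟨s', a⟩ := a
      cases hT.degree _ _ hit
      exact h a hit

theorem IsCurtisTable.eq_matchingTable (hT : IsCurtisTable d b T) :
    T = matchingTable (tagRel T) := by
  ext it
  cases it with
  | untagged x =>
    obtain ⟨s, i⟩ := x
    rw [untagged_mem_matchingTable]
    refine ⟨fun h => ⟨fun hi => ?_, fun a ha => ?_⟩, fun h => ?_⟩
    · cases s with
      | zero => exact hi
      | succ s =>
        obtain ⟨c, -, hc⟩ := hi
        cases hT.eq_of_contains h hc rfl (.inl rfl)
    · cases hT.eq_of_contains h ha rfl (.inr rfl)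
    · obtain ⟨it, hit, hx⟩ := (hT.once ⟨s, i⟩).exists
      cases it with
      | untagged x => exact hx ▸ hit
      | tag a c =>
        obtain ⟨⟨_, a⟩, ⟨s', c⟩⟩ := a, c
        cases hT.degree _ _ hit
        exact absurd h (not_isFree_of_contains hit hx)
  | tag a c =>
    obtain ⟨⟨_, a⟩, ⟨s, c⟩⟩ := a, c
    constructor
    · intro h
      cases hT.degree _ _ h
      exact tag_mem_matchingTable.2 h
    · rintro (⟨_, _, _, hx⟩ | ⟨_, _, _, h, hx⟩) <;> cases hx
      exact h

theorem IsCurtisTable.untagged_mem_iff (hT : IsCurtisTable d b T) {x : Σ s, I s} :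
    .untagged x ∈ T ↔ IsFree (tagRel T) x.1 x.2 := by
  nth_rw 1 [hT.eq_matchingTable]
  exact untagged_mem_matchingTable

theorem IsCurtisTable.unique [∀ s, WellFoundedLT (I s)] {T' : Set (Item (Σ s, I s))}
    (hdd : ∀ s x, d (s + 1) (d s x) = 0) (hT : IsCurtisTable d b T) (hT' : IsCurtisTable d b T') :
    T = T' := by
  have h_tagRel : tagRel T = tagRel T' := by
    ext s a c
    rw [hT.isCurtisMatching.iff_isLeast hdd, hT'.isCurtisMatching.iff_isLeast hdd]
  rw [hT.eq_matchingTable, hT'.eq_matchingTable, h_tagRel]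

theorem existsUnique_isCurtisTable [∀ s, WellFoundedLT (I s)]
    (b : ∀ s, Module.Basis (I s) (ZMod 2) (X s)) (hdd : ∀ s x, d (s + 1) (d s x) = 0) :
    ∃! T, IsCurtisTable d b T := by
  obtain ⟨g, hg, h_lead⟩ := (isCurtisMatching_isLeast hdd).exists_isCanonicalForm (b := b) hdd
  exact ⟨_, hg.isCurtisTable h_lead, fun T hT => hT.unique hdd (hg.isCurtisTable h_lead)⟩

end CurtisMatching

/-! ### The spectral sequence in terms of a canonical form -/

theorem exists_basis_quotient {R X I ι : Type*} [Ring R] [AddCommGroup X] [Module R X]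
    (g : Module.Basis I R X) {S S' : Set I} {W W' : Submodule R X}
    (hW : W = Submodule.span R (g '' S)) (hW' : W' = Submodule.span R (g '' S')) {f : ι → I}
    (hf : Function.Injective f) (h_range : Set.range f = S \ S') :
    ∃ B : Module.Basis ι R (W ⧸ W'.submoduleOf W),
      ∀ (x : W) (u : ι), B.repr (Submodule.Quotient.mk x) u = g.repr x (f u) := by
  let F : W →ₗ[R] ι →₀ R :=
    Finsupp.lcomapDomain f hf ∘ₗ g.repr.toLinearMap ∘ₗ W.subtype
  have h_surj : Function.Surjective F := by
    intro c
    have h_mem : Finsupp.linearCombination R (g ∘ f) c ∈ W := by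
      rw [Finsupp.linearCombination_apply]
      refine sum_mem fun u _ => Submodule.smul_mem _ _ ?_
      exact hW ▸ Submodule.subset_span ⟨f u, (h_range.subset ⟨u, rfl⟩).1, rfl⟩
    refine ⟨⟨_, h_mem⟩, Finsupp.ext fun u => ?_⟩
    change g.repr (Finsupp.linearCombination R (g ∘ f) c) (f u) = c u
    rw [← Finsupp.linearCombination_mapDomain, g.repr_linearCombination,
      Finsupp.mapDomain_apply hf]
  have h_ker : W'.submoduleOf W = LinearMap.ker F := by
    ext x
    change x.1 ∈ W' ↔ F x = 0
    have hx : ↑(g.repr x.1).support ⊆ S := g.mem_span_image.1 (hW ▸ x.2)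
    rw [hW', g.mem_span_image, Finsupp.ext_iff]
    constructor
    · intro hx' u
      by_contra hu
      exact (h_range.subset ⟨u, rfl⟩).2 (hx' (Finsupp.mem_support_iff.2 hu))
    · intro hx' i hi
      by_contra hi'
      obtain ⟨u, rfl⟩ := h_range.superset ⟨hx hi, hi'⟩
      exact Finsupp.mem_support_iff.1 hi (hx' u)
  exact ⟨.ofRepr ((Submodule.quotEquivOfEq _ _ h_ker).trans (F.quotKerEquivOfSurjective h_surj)),
    fun _ _ => rfl⟩

section TagsBelow

variable {I : ℕ → Type*} {wt : ∀ s, I s → ℤ} {τ : ∀ s, I (s + 1) → I s → Prop} {r : ℤ} {s : ℕ}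

/-- The tags `a ← c` along which the filtration degree drops by less than `r`: those that are
used up before the `r`-th page of the spectral sequence. -/
def tagsBelow (wt : ∀ s, I s → ℤ) (τ : ∀ s, I (s + 1) → I s → Prop) (r : ℤ) (s : ℕ)
    (a : I (s + 1)) (c : I s) : Prop :=
  τ s a c ∧ wt s c - wt (s + 1) a < r

/-- The tags `a ← c` between the labels in `U` along which the filtration degree drops by
exactly `r`: those of the `r`-th page of the spectral sequence. -/
def pageTags (wt : ∀ s, I s → ℤ) (τ : ∀ s, I (s + 1) → I s → Prop) (U : ∀ s, Set (I s)) (r : ℤ)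
    (s : ℕ) (a : U (s + 1)) (c : U s) : Prop :=
  τ s a c ∧ wt s c - wt (s + 1) a = r

theorem IsFree.mono {τ' : ∀ s, I (s + 1) → I s → Prop} {i : I s} (hi : IsFree τ s i)
    (h : ∀ s a c, τ' s a c → τ s a c) : IsFree τ' s i := by
  refine ⟨fun h_head => hi.1 ?_, fun a ha => hi.2 a (h s a i ha)⟩
  cases s with
  | zero => exact h_head
  | succ s =>
    obtain ⟨c, -, hc⟩ := h_head
    exact ⟨c, trivial, h s i c hc⟩

theorem isFree_tagsBelow_head (hτ : IsMatching τ) {a : I (s + 1)} {c : I s} (hac : τ s a c)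
    (hr : r ≤ wt s c - wt (s + 1) a) : IsFree (tagsBelow wt τ r) (s + 1) a := by
  refine ⟨fun ⟨c', _, h, h_lt⟩ => ?_, fun a' ha' => hτ.not_source hac ha'.1⟩
  obtain rfl := hτ.source_unique h hac
  exact h_lt.not_ge hr

theorem isFree_tagsBelow_source (hτ : IsMatching τ) {a : I (s + 1)} {c : I s} (hac : τ s a c)
    (hr : r ≤ wt s c - wt (s + 1) a) : IsFree (tagsBelow wt τ r) s c := by
  refine ⟨fun h => ?_, fun a' ⟨h, h_lt⟩ => ?_⟩
  · cases s with
    | zero => exact h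
    | succ s =>
      obtain ⟨c', -, hc'⟩ := h
      exact hτ.not_source hc'.1 hac
  · obtain rfl := hτ.head_unique h hac
    exact h_lt.not_ge hr

theorem isFree_iff_forall_isFree_tagsBelow {i : I s} :
    IsFree τ s i ↔ ∀ r : ℕ, IsFree (tagsBelow wt τ r) s i := by
  refine ⟨fun h r => h.mono fun _ _ _ => And.left, fun h => ⟨fun h_head => ?_, fun a ha => ?_⟩⟩
  · cases s with
    | zero => exact h_head
    | succ s =>
      obtain ⟨c, -, hc⟩ := h_head
      exact (h (wt s c - wt (s + 1) i + 1).toNat).1 ⟨c, trivial, hc, by lia⟩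
  · exact (h (wt s i - wt (s + 1) a + 1).toNat).2 a ⟨ha, by lia⟩

theorem IsMatching.isMatching_pageTags (hτ : IsMatching τ) (U : ∀ s, Set (I s)) (r : ℤ) :
    IsMatching (I := fun s => U s) (pageTags wt τ U r) where
  head_unique h h' := Subtype.ext (hτ.head_unique h.1 h'.1)
  source_unique h h' := Subtype.ext (hτ.source_unique h.1 h'.1)
  not_source h h' := hτ.not_source h.1 h'.1

theorem isFree_tagsBelow_succ_iff (hτ : IsMatching τ) {U : ∀ s, Set (I s)}
    (hU : ∀ s i, i ∈ U s ↔ IsFree (tagsBelow wt τ r) s i) {i : I s} :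
    IsFree (tagsBelow wt τ (r + 1)) s i ↔
      ∃ h : i ∈ U s, IsFree (I := fun s => U s) (pageTags wt τ U r) s ⟨i, h⟩ := by
  constructor
  · intro h
    refine ⟨(hU s i).2 (h.mono fun s a c hac => ⟨hac.1, by linarith [hac.2]⟩), fun h_head => ?_,
      fun a ha => h.2 a ⟨ha.1, by linarith [ha.2]⟩⟩
    cases s with
    | zero => exact h_head
    | succ s =>
      obtain ⟨c, -, hc⟩ := h_head
      exact h.1 ⟨c, trivial, hc.1, by linarith [hc.2]⟩
  · rintro ⟨hi, h⟩
    have hi' := (hU s i).1 hi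
    refine ⟨fun h_head => ?_, fun a ha => ?_⟩
    · cases s with
      | zero => exact h_head
      | succ s =>
        obtain ⟨c, -, hc, h_lt⟩ := h_head
        have h_ge : r ≤ wt s c - wt (s + 1) i := not_lt.1 fun h_lt => hi'.1 ⟨c, trivial, hc, h_lt⟩
        exact h.1 ⟨⟨c, (hU s c).2 (isFree_tagsBelow_source hτ hc h_ge)⟩, trivial, hc, by lia⟩
    · have h_ge : r ≤ wt s i - wt (s + 1) a := not_lt.1 fun h_lt => hi'.2 a ⟨ha.1, h_lt⟩
      exact h.2 ⟨a, (hU _ a).2 (isFree_tagsBelow_head hτ ha.1 h_ge)⟩ ⟨ha.1, by linarith [ha.2]⟩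

/-- The labels of the canonical basis elements that lie in `Z_r^n`. -/
def zLabels (wt : ∀ s, I s → ℤ) (τ : ∀ s, I (s + 1) → I s → Prop) (r n : ℤ) (s : ℕ) : Set (I s) :=
  {i | wt s i ≤ n ∧ ∀ a, τ s a i → wt (s + 1) a ≤ n - r}

theorem mem_zLabels_diff_iff (hτ : IsMatching τ) {n : ℤ} {i : I s} :
    i ∈ zLabels wt τ r n s \
        (zLabels wt τ (r - 1) (n - 1) s ∪ heads τ (zLabels wt τ (r - 1) (n + r - 1)) s) ↔
      wt s i = n ∧ IsFree (tagsBelow wt τ r) s i := by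
  constructor
  · rintro ⟨⟨h_le, h_source⟩, h_not⟩
    have h_eq : wt s i = n := by
      by_contra h_ne
      exact h_not (.inl ⟨by lia, fun a ha => by linarith [h_source a ha]⟩)
    refine ⟨h_eq, fun h_head => ?_, fun a ⟨ha, h_lt⟩ => by linarith [h_source a ha]⟩
    cases s with
    | zero => exact h_head
    | succ s =>
      obtain ⟨c, -, hc, h_lt⟩ := h_head
      refine h_not (.inr ⟨c, ⟨by linarith, fun a ha => ?_⟩, hc⟩)
      rw [hτ.head_unique ha hc]
      linarith
  · rintro ⟨rfl, h_head, h_source⟩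
    refine ⟨⟨le_rfl, fun a ha => ?_⟩, ?_⟩
    · linarith [not_lt.1 fun h_lt => h_source a ⟨ha, h_lt⟩]
    · rintro (h | h)
      · linarith [h.1]
      · cases s with
        | zero => exact h
        | succ s =>
          obtain ⟨c, h_c, hc⟩ := h
          exact h_head ⟨c, trivial, hc, by linarith [h_c.1]⟩

theorem isFree_tagsBelow_natCast_succ_iff (hτ : IsMatching τ) {r : ℕ} {U : ∀ s, Set (I s)}
    (hU : ∀ s i, i ∈ U s ↔ IsFree (tagsBelow wt τ r) s i) {i : I s} :
    IsFree (tagsBelow wt τ (r + 1 : ℕ)) s i ↔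
      ∃ h : i ∈ U s, .untagged ⟨s, i, h⟩ ∈
        matchingTable (I := fun s => U s) (pageTags wt τ U r) := by
  simp only [untagged_mem_matchingTable, Nat.cast_succ]
  exact isFree_tagsBelow_succ_iff hτ hU

end TagsBelow

namespace FilteredComplex

variable {C : FilteredComplex.{u}} {I : ℕ → Type w}
  {b g : ∀ s, Module.Basis (I s) (ZMod 2) (C.X s)} {wt : ∀ s, I s → ℤ}
  {τ : ∀ s, I (s + 1) → I s → Prop} {r n : ℤ} {s : ℕ}

theorem boundaries_span (hτ : IsCanonicalForm C.d g τ) (S : ∀ s, Set (I s)) (s : ℕ) :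
    C.boundaries (fun s => Submodule.span (ZMod 2) (g s '' S s)) s =
      Submodule.span (ZMod 2) (g s '' heads τ S s) := by
  cases s with
  | zero => simp [boundaries, heads]
  | succ s =>
    rw [boundaries, Submodule.map_span]
    refine le_antisymm (Submodule.span_le.2 ?_) (Submodule.span_le.2 ?_)
    · rintro _ ⟨_, ⟨c, hc, rfl⟩, rfl⟩
      by_cases h : ∃ a, τ s a c
      · obtain ⟨a, ha⟩ := h
        exact hτ.d_source ha ▸ Submodule.subset_span ⟨a, ⟨c, hc, ha⟩, rfl⟩
      · rw [hτ.d_eq_zero (not_exists.1 h)]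
        exact zero_mem _
    · rintro _ ⟨a, ⟨c, hc, ha⟩, rfl⟩
      exact Submodule.subset_span ⟨_, ⟨c, hc, rfl⟩, hτ.d_source ha⟩

variable [∀ s, LinearOrder (I s)]

/-- The basis elements of filtration degree `≤ n` span the `n`-th stage of the filtration, and
later basis elements have higher filtration degree; `wt s i` is the filtration degree of
`b s i`. -/
structure IsAdapted (b : ∀ s, Module.Basis (I s) (ZMod 2) (C.X s)) (wt : ∀ s, I s → ℤ) : Prop where
  monotone : ∀ s, Monotone (wt s)
  mem_fil_iff : ∀ n s x, x ∈ C.fil n s ↔ ∀ i, n < wt s i → (b s).repr x i = 0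

namespace IsAdapted

theorem mem_fil_of_isLeading (hb : IsAdapted b wt) {x : C.X s} {i : I s}
    (hx : IsLeading (b s) x i) : x ∈ C.fil (wt s i) s := by
  refine (hb.mem_fil_iff _ _ _).2 fun j hj => ?_
  by_contra h
  exact hj.not_ge (hb.monotone s (hx.le_of_repr_ne_zero h))

theorem wt_le_of_isLeading (hb : IsAdapted b wt) {x : C.X s} {i : I s}
    (hi : IsLeading (b s) x i) (hx : x ∈ C.fil n s) : wt s i ≤ n :=
  not_lt.1 fun h => hi.1 ((hb.mem_fil_iff n s x).1 hx i h)

theorem of_isLeading (hb : IsAdapted b wt) (hg : ∀ s i, IsLeading (b s) (g s i) i) :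
    IsAdapted g wt where
  monotone := hb.monotone
  mem_fil_iff n s x := by
    have h_iff (i : I s) : IsLeading (g s) x i ↔ IsLeading (b s) x i :=
      isLeading_iff_of_isLeading (hg s)
    rcases eq_or_ne x 0 with rfl | h_ne
    · simp
    obtain ⟨i, hi⟩ := exists_isLeading (b s) h_ne
    constructor
    · intro hx j hj
      by_contra h
      have h_le := hb.monotone s (((h_iff i).2 hi).le_of_repr_ne_zero h)
      exact (hb.wt_le_of_isLeading hi hx).not_gt (hj.trans_le h_le)
    · intro hx
      refine C.fil_mono _ _ (not_lt.1 fun h => ?_) s (hb.mem_fil_of_isLeading hi)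
      exact ((h_iff i).2 hi).1 (hx i h)

theorem fil_eq_span (hg : IsAdapted g wt) (n : ℤ) (s : ℕ) :
    C.fil n s = Submodule.span (ZMod 2) (g s '' {i | wt s i ≤ n}) := by
  ext x
  rw [hg.mem_fil_iff, (g s).mem_span_image]
  refine forall_congr' fun i => ?_
  rw [SetLike.mem_coe, Finsupp.mem_support_iff, Set.mem_ofPred_eq, ← not_lt]
  tauto

theorem basis_mem_fil_iff (hg : IsAdapted g wt) {i : I s} : g s i ∈ C.fil n s ↔ wt s i ≤ n := by
  rw [hg.fil_eq_span, (g s).mem_span_image]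
  simp

end IsAdapted

theorem wt_head_le (hg : IsAdapted g wt) (hτ : IsCanonicalForm C.d g τ) {a : I (s + 1)} {c : I s}
    (hac : τ s a c) : wt (s + 1) a ≤ wt s c := by
  rw [← hg.basis_mem_fil_iff, ← hτ.d_source hac]
  exact C.d_mem _ _ _ (hg.basis_mem_fil_iff.2 le_rfl)

theorem isFree_tagsBelow_zero (hg : IsAdapted g wt) (hτ : IsCanonicalForm C.d g τ) (i : I s) :
    IsFree (tagsBelow wt τ 0) s i := by
  have h_empty {s} {a : I (s + 1)} {c : I s} : ¬ tagsBelow wt τ 0 s a c :=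
    fun ⟨hac, h_lt⟩ => by linarith [wt_head_le hg hτ hac]
  refine ⟨fun h => ?_, fun a => h_empty⟩
  cases s with
  | zero => exact h
  | succ s =>
    obtain ⟨c, -, hc⟩ := h
    exact h_empty hc

theorem Z_eq_span (hg : IsAdapted g wt) (hτ : IsCanonicalForm C.d g τ) (r n : ℤ) (s : ℕ) :
    C.Z r n s = Submodule.span (ZMod 2) (g s '' zLabels wt τ r n s) := by
  ext x
  have h_d : C.d s x ∈ C.fil (n - r) (s + 1) ↔
      ∀ c, (g s).repr x c ≠ 0 → ∀ a, τ s a c → wt (s + 1) a ≤ n - r := by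
    rw [hg.mem_fil_iff]
    constructor
    · intro h c hc a hac
      by_contra h_lt
      exact hc (hτ.repr_d hac x ▸ h a (not_le.1 h_lt))
    · intro h a h_lt
      by_cases ha : ∃ c, τ s a c
      · obtain ⟨c, hac⟩ := ha
        rw [hτ.repr_d hac]
        by_contra hc
        exact h_lt.not_ge (h c hc a hac)
      · exact hτ.repr_d_eq_zero (not_exists.1 ha) x
  rw [Z, Submodule.mem_inf, Submodule.mem_comap, h_d, hg.fil_eq_span, (g s).mem_span_image,
    (g s).mem_span_image]
  simp only [Set.subset_def, SetLike.mem_coe, Finsupp.mem_support_iff]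
  exact forall₂_and.symm

theorem D_eq_span (hg : IsAdapted g wt) (hτ : IsCanonicalForm C.d g τ) (r n : ℤ) (s : ℕ) :
    C.D r n s = Submodule.span (ZMod 2) (g s ''
      (zLabels wt τ (r - 1) (n - 1) s ∪ heads τ (zLabels wt τ (r - 1) (n + r - 1)) s)) := by
  have h_Z : C.Z (r - 1) (n + r - 1) =
      fun s => Submodule.span (ZMod 2) (g s '' zLabels wt τ (r - 1) (n + r - 1) s) :=
    funext (Z_eq_span hg hτ _ _)
  rw [D, h_Z, boundaries_span hτ, Z_eq_span hg hτ, ← Submodule.span_union, ← Set.image_union]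

theorem basis_mem_Z (hg : IsAdapted g wt) (hτ : IsCanonicalForm C.d g τ) {i : I s}
    (hi : IsFree (tagsBelow wt τ r) s i) : g s i ∈ C.Z r (wt s i) s := by
  rw [Z_eq_span hg hτ]
  exact Submodule.subset_span ⟨i, ((mem_zLabels_diff_iff hτ.toIsMatching).2 ⟨rfl, hi⟩).1, rfl⟩

/-- The basis of `E_r`, labelled by `U`, of the classes of those elements of the basis `g` that
survive to `E_r`: the `i`-th coordinate of the class of `x ∈ Z_r^n` is that of `x` if `i` has
filtration degree `n`, and zero otherwise. -/
def IsPageBasis (g : ∀ s, Module.Basis (I s) (ZMod 2) (C.X s)) (wt : ∀ s, I s → ℤ) {r : ℤ}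
    {s : ℕ} {U : Set (I s)} (γ : Module.Basis U (ZMod 2) (C.Page r s)) : Prop :=
  ∀ (n : ℤ) (x : C.Z r n s) (i : U),
    γ.repr (C.cls r n s x) i = if wt s i = n then (g s).repr x i else 0

theorem exists_isPageBasis (hg : IsAdapted g wt) (hτ : IsCanonicalForm C.d g τ) {U : Set (I s)}
    (hU : ∀ i, i ∈ U ↔ IsFree (tagsBelow wt τ r) s i) :
    ∃ γ : Module.Basis U (ZMod 2) (C.Page r s), IsPageBasis g wt γ := by
  have h_range (n : ℤ) : Set.range (fun i : {i : U // wt s i = n} => i.1.1) =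
      zLabels wt τ r n s \
        (zLabels wt τ (r - 1) (n - 1) s ∪ heads τ (zLabels wt τ (r - 1) (n + r - 1)) s) := by
    ext i
    rw [mem_zLabels_diff_iff hτ.toIsMatching, ← hU]
    exact ⟨fun ⟨i, hi⟩ => hi ▸ ⟨i.2, i.1.2⟩, fun ⟨h_wt, hi⟩ => ⟨⟨⟨i, hi⟩, h_wt⟩, rfl⟩⟩
  choose B hB using fun n => exists_basis_quotient (g s) (Z_eq_span hg hτ r n s)
    (D_eq_span hg hτ r n s) (Subtype.val_injective.comp Subtype.val_injective) (h_range n)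
  refine ⟨(DFinsupp.basis B).reindex (Equiv.sigmaFiberEquiv fun i : U => wt s i), fun n x i => ?_⟩
  have h_repr (y : C.Page r s) :
      ((DFinsupp.basis B).reindex (Equiv.sigmaFiberEquiv fun i : U => wt s i)).repr y i =
        (B (wt s i)).repr (y (wt s i)) ⟨i, rfl⟩ := by
    rfl
  rw [h_repr, cls, LinearMap.comp_apply]
  split_ifs with h
  · subst h
    rw [DirectSum.lof_apply]
    exact hB _ _ _
  · rw [DirectSum.lof_eq_of, DirectSum.of_eq_of_ne _ _ _ h, map_zero, Finsupp.zero_apply]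

theorem dPage_cls (x : C.Z r n s) :
    C.dPage r s (C.cls r n s x) = C.cls r (n - r) (s + 1) (C.dZ r n s x) := by
  simp [dPage, cls, dE]

namespace IsPageBasis

variable {U : Set (I s)} {γ : Module.Basis U (ZMod 2) (C.Page r s)}

theorem cls_eq (hγ : IsPageBasis g wt γ) {i : U} (hi : g s i ∈ C.Z r (wt s i) s) :
    C.cls r (wt s i) s ⟨g s i, hi⟩ = γ i := by
  refine γ.ext_elem fun j => ?_
  rw [hγ, γ.repr_self, (g s).repr_self]
  classical
  simp only [Finsupp.single_apply, Subtype.ext_iff]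
  grind

theorem isLeading_cls (hγ : IsPageBasis g wt γ) {i : U} {x : C.X s} (hx : x ∈ C.Z r (wt s i) s)
    (h : IsLeading (g s) x i) : IsLeading γ (C.cls r (wt s i) s ⟨x, hx⟩) i := by
  refine ⟨by simpa [hγ _ _ _] using h.1, fun j hj => ?_⟩
  rw [hγ, h.2 j hj, ite_self]

theorem isLeading_cls_of_subset (hγ : IsPageBasis g wt γ) {r' : ℤ} {U' : Set (I s)}
    {γ' : Module.Basis U' (ZMod 2) (C.Page r' s)} (hγ' : IsPageBasis g wt γ') (hUU' : U' ⊆ U)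
    {i : I s} (hi : i ∈ U') {x : C.X s} (hx : x ∈ C.Z r (wt s i) s) (hx' : x ∈ C.Z r' (wt s i) s)
    (h : IsLeading γ (C.cls r (wt s i) s ⟨x, hx⟩) ⟨i, hUU' hi⟩) :
    IsLeading γ' (C.cls r' (wt s i) s ⟨x, hx'⟩) ⟨i, hi⟩ := by
  have h_repr (j : U') : γ'.repr (C.cls r' (wt s i) s ⟨x, hx'⟩) j =
      γ.repr (C.cls r (wt s i) s ⟨x, hx⟩) ⟨j, hUU' j.2⟩ := by
    rw [hγ, hγ']
  exact ⟨by simpa only [h_repr] using h.1, fun j hj => (h_repr j).trans (h.2 _ hj)⟩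

end IsPageBasis

theorem isCanonicalForm_dPage (hg : IsAdapted g wt) (hτ : IsCanonicalForm C.d g τ)
    {U : ∀ s, Set (I s)} (hU : ∀ s i, i ∈ U s ↔ IsFree (tagsBelow wt τ r) s i)
    {γ : ∀ s, Module.Basis (U s) (ZMod 2) (C.Page r s)} (hγ : ∀ s, IsPageBasis g wt (γ s)) :
    IsCanonicalForm (I := fun s => U s) (C.dPage r) γ (pageTags wt τ U r) := by
  have h_mem {s} (i : U s) : g s i ∈ C.Z r (wt s i) s := basis_mem_Z hg hτ ((hU s i).1 i.2)
  have h_repr {s} (c : U s) (a : U (s + 1)) : (γ (s + 1)).repr (C.dPage r s (γ s c)) a =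
      if wt (s + 1) a = wt s c - r then (g (s + 1)).repr (C.d s (g s c)) a else 0 := by
    rw [← (hγ s).cls_eq (h_mem c), dPage_cls, hγ]
    rfl
  refine { hτ.toIsMatching.isMatching_pageTags U r with d_source := ?_, d_eq_zero := ?_ }
  · intro s a c ⟨hac, h_drop⟩
    have h_wt : wt s c - r = wt (s + 1) a := by lia
    refine (γ (s + 1)).ext_elem fun a' => ?_
    rw [h_repr, hτ.d_source hac, h_wt, ← (hγ _).cls_eq (h_mem a), hγ]
  · intro s c hc
    refine (γ (s + 1)).ext_elem fun a => ?_
    rw [h_repr, map_zero, Finsupp.zero_apply, ite_eq_right_iff]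
    intro h_wt
    by_cases h : ∃ a', τ s a' c
    · obtain ⟨a', ha'⟩ := h
      have h_ne : a' ≠ a := fun h_eq => hc a ⟨h_eq ▸ ha', by lia⟩
      simp [hτ.d_source ha', h_ne]
    · simp [hτ.d_eq_zero (not_exists.1 h)]

theorem exists_basis_eq_cls [WellFoundedLT (I s)] (hg : IsAdapted g wt)
    (hb : ∀ s i, IsLeading (g s) (b s i) i) {U : Set (I s)}
    {γ : Module.Basis U (ZMod 2) (C.Page 0 s)} (hγ : IsPageBasis g wt γ) :
    ∃ β : Module.Basis U (ZMod 2) (C.Page 0 s), (∀ i, IsLeading γ (β i) i) ∧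
      ∀ i : U, ∃ h : b s i ∈ C.Z 0 (wt s i) s, β i = C.cls 0 (wt s i) s ⟨b s i, h⟩ := by
  have h_mem (i : U) : b s i ∈ C.Z 0 (wt s i) s := by
    have h_fil := hg.mem_fil_of_isLeading (hb s i)
    exact ⟨h_fil, by simpa using C.d_mem _ _ _ h_fil⟩
  have h_lead (i : U) : IsLeading γ (C.cls 0 (wt s i) s ⟨b s i, h_mem i⟩) i :=
    hγ.isLeading_cls (h_mem i) (hb s i)
  obtain ⟨β, hβ⟩ := exists_basis_of_isLeading (X := C.Page 0 s) h_lead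
  exact ⟨β, fun i => congrFun hβ i ▸ h_lead i, fun i => ⟨h_mem i, congrFun hβ i⟩⟩

theorem IsAdapted.exists_isCanonicalForm [∀ s, WellFoundedLT (I s)] (hb : IsAdapted b wt)
    (hτ : IsCurtisMatching C.d b τ) :
    ∃ g : ∀ s, Module.Basis (I s) (ZMod 2) (C.X s), IsAdapted g wt ∧ IsCanonicalForm C.d g τ ∧
      ∀ s i, IsLeading (b s) (g s i) i := by
  obtain ⟨g, hgτ, h_lead⟩ := hτ.exists_isCanonicalForm C.d_d
  exact ⟨g, hb.of_isLeading h_lead, hgτ, h_lead⟩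

theorem IsAdapted.nonempty_labelledPages [∀ s, WellFoundedLT (I s)] (hb : IsAdapted b wt) :
    Nonempty (C.LabelledPages b wt) := by
  obtain ⟨g, hg, hτ, h_lead⟩ := hb.exists_isCanonicalForm (isCurtisMatching_isLeast C.d_d)
  set τ := fun s a c => IsLeast (boundarySources C.d b s a) c
  let U (r s : ℕ) : Set (I s) := {i | IsFree (tagsBelow wt τ r) s i}
  have hU (r s : ℕ) (i : I s) : i ∈ U r s ↔ IsFree (tagsBelow wt τ r) s i := Iff.rfl
  choose γ hγ using fun r s => exists_isPageBasis hg hτ (hU r s)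
  choose β₀ h_β₀ hβ₀ using fun s =>
    exists_basis_eq_cls hg (fun s => isLeading_symm (h_lead s)) (hγ 0 s)
  let β : ∀ r s : ℕ, Module.Basis (U r s) (ZMod 2) (C.Page r s)
    | 0, s => β₀ s
    | r + 1, s => γ (r + 1) s
  have h_γβ (r s : ℕ) (i : U r s) : IsLeading (β r s) (γ r s i) i := by
    cases r with
    | zero => exact isLeading_symm (h_β₀ s) i
    | succ r => exact isLeading_self _ i
  refine ⟨{
    U, β
    T := fun r => matchingTable (I := fun s => U r s) (pageTags wt τ (U r) r)
    U_zero := fun s => Set.eq_univ_of_forall (isFree_tagsBelow_zero hg hτ)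
    β_zero := hβ₀
    isCurtisTable := fun r => (isCanonicalForm_dPage hg hτ (hU r) (hγ r)).isCurtisTable (h_γβ r)
    U_succ := fun r s i => isFree_tagsBelow_natCast_succ_iff hτ.toIsMatching (hU r)
    β_succ := fun r s i => ?_ }⟩
  obtain ⟨hi, -⟩ := (isFree_tagsBelow_natCast_succ_iff hτ.toIsMatching (hU r)).1 i.2
  refine ⟨hi, g s i, basis_mem_Z hg hτ hi, basis_mem_Z hg hτ i.2, ?_,
    ((hγ (r + 1) s).cls_eq _).symm⟩
  exact (hγ r s).cls_eq (i := ⟨i, hi⟩) (basis_mem_Z hg hτ hi) ▸ h_γβ r s ⟨i, hi⟩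

namespace LabelledPages

variable (P : C.LabelledPages b wt)

theorem T_eq_matchingTable [∀ s, WellFoundedLT (I s)] (hg : IsAdapted g wt)
    (hτ : IsCanonicalForm C.d g τ) {r : ℕ}
    (hU : ∀ s i, i ∈ P.U r s ↔ IsFree (tagsBelow wt τ r) s i)
    (h_lead : ∀ (s : ℕ) (γ : Module.Basis (P.U r s) (ZMod 2) (C.Page r s)), IsPageBasis g wt γ →
      ∀ i, IsLeading γ (P.β r s i) i) :
    P.T r = matchingTable (I := fun s => P.U r s) (pageTags wt τ (P.U r) r) := by
  choose γ hγ using fun s => exists_isPageBasis hg hτ (hU s)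
  have h_canonical := isCanonicalForm_dPage hg hτ hU hγ
  exact IsCurtisTable.unique (X := C.Page r) h_canonical.d_d (P.isCurtisTable r)
    (h_canonical.isCurtisTable fun s => isLeading_symm (h_lead s (γ s) (hγ s)))

theorem mem_U_iff_and_isLeading [∀ s, WellFoundedLT (I s)] (hg : IsAdapted g wt)
    (hτ : IsCanonicalForm C.d g τ) (hb : ∀ s i, IsLeading (g s) (b s i) i) (r : ℕ) :
    (∀ s i, i ∈ P.U r s ↔ IsFree (tagsBelow wt τ r) s i) ∧
      ∀ (s : ℕ) (γ : Module.Basis (P.U r s) (ZMod 2) (C.Page r s)), IsPageBasis g wt γ →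
        ∀ i, IsLeading γ (P.β r s i) i := by
  induction r with
  | zero =>
    refine ⟨fun s i => ?_, fun s γ hγ i => ?_⟩
    · simpa [P.U_zero] using isFree_tagsBelow_zero hg hτ i
    · obtain ⟨h, hi⟩ := P.β_zero s i
      exact hi ▸ hγ.isLeading_cls h (hb s i)
  | succ r ih =>
    obtain ⟨hU, h_lead⟩ := ih
    refine ⟨fun s i => ?_, fun s γ' hγ' i => ?_⟩
    · rw [P.U_succ, P.T_eq_matchingTable hg hτ hU h_lead,
        isFree_tagsBelow_natCast_succ_iff hτ.toIsMatching hU]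
    · obtain ⟨γ, hγ⟩ := exists_isPageBasis hg hτ (hU s)
      obtain ⟨hi, x, hx, hx', hxi, h_eq⟩ := P.β_succ r s i
      have h_subset : P.U (r + 1) s ⊆ P.U r s := fun j hj => ((P.U_succ r s j).1 hj).1
      exact h_eq ▸ hγ.isLeading_cls_of_subset hγ' h_subset i.2 hx hx'
        ((isLeading_iff_of_isLeading (h_lead s γ hγ)).1 hxi)

variable {T : Set (Item (Σ s, I s))}

theorem tag_mem_tags_iff [∀ s, WellFoundedLT (I s)] (hb : IsAdapted b wt)
    (hT : IsCurtisTable C.d b T) {r : ℕ} {a c : Σ s, I s} :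
    .tag a c ∈ P.tags r ↔ .tag a c ∈ T ∧ wt a.1 a.2 = wt c.1 c.2 - r := by
  obtain ⟨g, hg, hτ, h_lead⟩ := hb.exists_isCanonicalForm hT.isCurtisMatching
  obtain ⟨hU, hβ⟩ := P.mem_U_iff_and_isLeading hg hτ (fun s => isLeading_symm (h_lead s)) r
  have hPT := P.T_eq_matchingTable hg hτ hU hβ
  constructor
  · rintro ⟨_, _, h, h_eq⟩
    rw [hPT] at h
    rcases h with ⟨_, _, _, hx⟩ | ⟨s, a, c, ⟨hac, h_drop⟩, hx⟩ <;> cases hx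
    cases h_eq
    exact ⟨hac, by linarith⟩
  · rintro ⟨h, h_drop⟩
    obtain ⟨⟨_, a⟩, ⟨s, c⟩⟩ := a, c
    cases hT.degree _ _ h
    have h_ge : (r : ℤ) ≤ wt s c - wt (s + 1) a := by linarith
    refine ⟨⟨s + 1, a, (hU _ a).2 (isFree_tagsBelow_head hτ.toIsMatching h h_ge)⟩,
      ⟨s, c, (hU s c).2 (isFree_tagsBelow_source hτ.toIsMatching h h_ge)⟩, ?_, rfl⟩
    exact hPT ▸ tag_mem_matchingTable.2 ⟨h, by linarith⟩

theorem exists_eq_tag_of_mem_tags {r : ℕ} {it : Item (Σ s, I s)} (h : it ∈ P.tags r) :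
    ∃ a c, it = .tag a c :=
  let ⟨_, _, _, h_eq⟩ := h
  ⟨_, _, h_eq⟩

theorem tag_mem_iff_exists_mem_tags [∀ s, WellFoundedLT (I s)] (hb : IsAdapted b wt)
    (hT : IsCurtisTable C.d b T) {a c : Σ s, I s} :
    .tag a c ∈ T ↔ ∃ r, .tag a c ∈ P.tags r := by
  simp only [P.tag_mem_tags_iff hb hT]
  refine ⟨fun h => ?_, fun ⟨_, h, _⟩ => h⟩
  obtain ⟨g, hg, hτ, -⟩ := hb.exists_isCanonicalForm hT.isCurtisMatching
  obtain ⟨⟨s', a⟩, ⟨s, c⟩⟩ := a, c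
  obtain rfl : s' = s + 1 := hT.degree _ _ h
  have h_le : wt (s + 1) a ≤ wt s c := wt_head_le hg hτ h
  exact ⟨(wt s c - wt (s + 1) a).toNat, h, by dsimp only; omega⟩

theorem setOf_tag_notMem_tags_zero [∀ s, WellFoundedLT (I s)] (hb : IsAdapted b wt)
    (hT : IsCurtisTable C.d b T) :
    {it | it ∈ T ∧ (∃ a c, it = .tag a c) ∧ it ∉ P.tags 0} =
      {it | ∃ r : ℕ, 1 ≤ r ∧ it ∈ P.tags r} := by
  ext it
  constructor
  · rintro ⟨hit, ⟨a, c, rfl⟩, h_zero⟩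
    obtain ⟨r, hr⟩ := (P.tag_mem_iff_exists_mem_tags hb hT).1 hit
    exact ⟨r, Nat.one_le_iff_ne_zero.2 fun h => h_zero (h ▸ hr), hr⟩
  · rintro ⟨r, h_pos, hr⟩
    obtain ⟨a, c, rfl⟩ := P.exists_eq_tag_of_mem_tags hr
    refine ⟨(P.tag_mem_iff_exists_mem_tags hb hT).2 ⟨r, hr⟩, ⟨a, c, rfl⟩, fun h_zero => ?_⟩
    have h_r := ((P.tag_mem_tags_iff hb hT).1 hr).2
    have h_0 := ((P.tag_mem_tags_iff hb hT).1 h_zero).2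
    omega

theorem untagged_mem_iff_not_exists_mem_tags [∀ s, WellFoundedLT (I s)] (hb : IsAdapted b wt)
    (hT : IsCurtisTable C.d b T) {x : Σ s, I s} :
    .untagged x ∈ T ↔ ¬ ∃ it : Item (Σ s, I s), it.Contains x ∧
      (it ∈ P.tags 0 ∨ ∃ r : ℕ, 1 ≤ r ∧ it ∈ P.tags r) := by
  rw [hT.untagged_mem_iff_forall_not_contains]
  constructor
  · rintro h ⟨it, hx, h_mem⟩
    obtain ⟨r, hr⟩ : ∃ r, it ∈ P.tags r := h_mem.elim (⟨0, ·⟩) fun ⟨r, _, hr⟩ => ⟨r, hr⟩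
    obtain ⟨a, c, rfl⟩ := P.exists_eq_tag_of_mem_tags hr
    exact h a c ((P.tag_mem_iff_exists_mem_tags hb hT).2 ⟨r, hr⟩) hx
  · intro h a c hac hx
    obtain ⟨r, hr⟩ := (P.tag_mem_iff_exists_mem_tags hb hT).1 hac
    refine h ⟨_, hx, r.eq_zero_or_pos.imp (fun h_zero => ?_) fun h_pos => ⟨r, h_pos, hr⟩⟩
    exact h_zero ▸ hr

theorem untagged_mem_iff_forall_mem_U [∀ s, WellFoundedLT (I s)] (hb : IsAdapted b wt)
    (hT : IsCurtisTable C.d b T) {x : Σ s, I s} :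
    .untagged x ∈ T ↔ ∀ r, x.2 ∈ P.U r x.1 := by
  obtain ⟨g, hg, hτ, h_lead⟩ := hb.exists_isCanonicalForm hT.isCurtisMatching
  have hU (r : ℕ) := (P.mem_U_iff_and_isLeading hg hτ (fun s => isLeading_symm (h_lead s)) r).1
  rw [hT.untagged_mem_iff, isFree_iff_forall_isFree_tagsBelow (wt := wt)]
  exact forall_congr' fun r => (hU r x.1 x.2).symm

theorem exists_isLeading_cls_of_untagged_mem [∀ s, WellFoundedLT (I s)] (hb : IsAdapted b wt)
    (hT : IsCurtisTable C.d b T) {i : I s} (hi : .untagged ⟨s, i⟩ ∈ T) {z : C.X s}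
    (hz : C.d s z = 0) (hzi : IsLeading (b s) z i) (r : ℕ) :
    ∃ (h : i ∈ P.U r s) (h' : z ∈ C.Z r (wt s i) s),
      IsLeading (P.β r s) (C.cls r (wt s i) s ⟨z, h'⟩) ⟨i, h⟩ := by
  obtain ⟨g, hg, hτ, h_lead⟩ := hb.exists_isCanonicalForm hT.isCurtisMatching
  obtain ⟨hU, hβ⟩ := P.mem_U_iff_and_isLeading hg hτ (fun s => isLeading_symm (h_lead s)) r
  obtain ⟨γ, hγ⟩ := exists_isPageBasis hg hτ (hU s)
  have h_d : C.d s z ∈ C.fil (wt s i - r) (s + 1) := hz ▸ zero_mem _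
  have h_Z : z ∈ C.Z r (wt s i) s := ⟨hb.mem_fil_of_isLeading hzi, h_d⟩
  have h_U : i ∈ P.U r s := (P.untagged_mem_iff_forall_mem_U hb hT (x := ⟨s, i⟩)).1 hi r
  have h_gamma : IsLeading γ (C.cls r (wt s i) s ⟨z, h_Z⟩) ⟨i, h_U⟩ :=
    hγ.isLeading_cls (i := ⟨i, h_U⟩) h_Z ((isLeading_iff_of_isLeading (h_lead s)).2 hzi)
  exact ⟨h_U, h_Z, (isLeading_iff_of_isLeading (X := C.Page r s) (hβ s γ hγ)).2 h_gamma⟩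

end LabelledPages

theorem Zinf_eq_span (hg : IsAdapted g wt) (hτ : IsCanonicalForm C.d g τ) (n : ℤ) (s : ℕ) :
    C.Zinf n s =
      Submodule.span (ZMod 2) (g s '' {i | wt s i ≤ n ∧ ∀ a, ¬ τ s a i}) := by
  ext x
  rw [Zinf, Submodule.mem_inf, LinearMap.mem_ker, hτ.d_eq_zero_iff, hg.fil_eq_span,
    (g s).mem_span_image, (g s).mem_span_image]
  simp only [Set.subset_def, SetLike.mem_coe, Finsupp.mem_support_iff, Set.mem_ofPred_eq]
  grind

theorem fil_inf_boundaries_eq_span (hg : IsAdapted g wt) (hτ : IsCanonicalForm C.d g τ) (n : ℤ)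
    (s : ℕ) :
    C.fil n s ⊓ C.boundaries (fun _ => ⊤) s = Submodule.span (ZMod 2)
      (g s '' ({i | wt s i ≤ n} ∩ heads τ (fun _ => Set.univ) s)) := by
  have h_top : (fun _ => ⊤ : ∀ s, Submodule (ZMod 2) (C.X s)) =
      fun s => Submodule.span (ZMod 2) (g s '' Set.univ) :=
    funext fun s => by rw [Set.image_univ, (g s).span_eq]
  ext x
  rw [h_top, boundaries_span hτ, hg.fil_eq_span, Submodule.mem_inf, (g s).mem_span_image,
    (g s).mem_span_image, (g s).mem_span_image, Set.subset_inter_iff]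

theorem exists_basis_Einf_repr (hg : IsAdapted g wt) (hτ : IsCanonicalForm C.d g τ) {U : Set (I s)}
    (hU : ∀ i, i ∈ U ↔ IsFree τ s i) (n : ℤ) :
    ∃ B : Module.Basis {i : U // wt s i = n} (ZMod 2) (C.Einf n s),
      ∀ (x : C.Zinf n s) (i : {i : U // wt s i = n}),
        B.repr (Submodule.Quotient.mk x) i = (g s).repr x i.1 := by
  refine exists_basis_quotient (g s) (Zinf_eq_span hg hτ n s)
    (S' := {i | wt s i ≤ n - 1 ∧ ∀ a, ¬ τ s a i} ∪
      ({i | wt s i ≤ n} ∩ heads τ (fun _ => Set.univ) s))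
    (f := fun i : {i : U // wt s i = n} => i.1.1) ?_
    (Subtype.val_injective.comp Subtype.val_injective) ?_
  · rw [Zinf_eq_span hg hτ, fil_inf_boundaries_eq_span hg hτ, ← Submodule.span_union,
      ← Set.image_union]
  · ext i
    have hi : i ∈ U ↔ i ∉ heads τ (fun _ => Set.univ) s ∧ ∀ a, ¬ τ s a i := hU i
    simp only [Set.mem_range, Subtype.exists, Set.mem_sdiff, Set.mem_union, Set.mem_inter_iff,
      Set.mem_ofPred_eq]
    grind

theorem IsAdapted.exists_basis_Einf [∀ s, WellFoundedLT (I s)] (hb : IsAdapted b wt)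
    {T : Set (Item (Σ s, I s))} (hT : IsCurtisTable C.d b T)
    {z : {i : I s // .untagged ⟨s, i⟩ ∈ T} → C.X s}
    (hz : ∀ i, C.d s (z i) = 0 ∧ IsLeading (b s) (z i) i) (n : ℤ) :
    ∃ B : Module.Basis {i : {i : I s // .untagged ⟨s, i⟩ ∈ T} // wt s i = n} (ZMod 2) (C.Einf n s),
      ∀ i, ∃ h : z i.1 ∈ C.Zinf n s, B i = Submodule.Quotient.mk ⟨z i.1, h⟩ := by
  obtain ⟨g, hg, hτ, h_lead⟩ := hb.exists_isCanonicalForm hT.isCurtisMatching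
  obtain ⟨B₀, hB₀⟩ := exists_basis_Einf_repr hg hτ
    (U := {i : I s | Item.untagged (Sigma.mk s i) ∈ T}) (fun _ => hT.untagged_mem_iff) n
  have h_mem (i : {i : {i : I s // .untagged ⟨s, i⟩ ∈ T} // wt s i = n}) : z i.1 ∈ C.Zinf n s := by
    have h_fil := hb.mem_fil_of_isLeading (hz i.1).2
    exact ⟨by rwa [i.2] at h_fil, (hz i.1).1⟩
  have h_B₀ (i : {i : {i : I s // .untagged ⟨s, i⟩ ∈ T} // wt s i = n}) :
      IsLeading B₀ (Submodule.Quotient.mk ⟨z i.1, h_mem i⟩) i := by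
    obtain ⟨h_ne, h_zero⟩ := (isLeading_iff_of_isLeading (h_lead s)).2 (hz i).2
    exact ⟨by rwa [hB₀], fun j hj => (hB₀ _ _).trans (h_zero _ hj)⟩
  obtain ⟨B, hB⟩ := exists_basis_of_isLeading h_B₀
  exact ⟨B, fun i => ⟨h_mem i, congrFun hB i⟩⟩

end FilteredComplex

/-! ### The algebraic Atiyah–Hirzebruch filtration -/

namespace FreeResolution

variable {R : FreeResolution.{v, w}} {M : Type*} [AddCommGroup M] [Module (ZMod 2) M]
  [Module SteenrodAlgebra M] [IsScalarTower (ZMod 2) SteenrodAlgebra M]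
  {𝓜 : ℤ → Submodule (ZMod 2) M} {K : Type*} {e : Module.Basis K (ZMod 2) M} {degM : K → ℤ}
  {t : ℤ} {s : ℕ}

section Label

variable (R degM t s) in
/-- The label `e_k ⊗ r_j`, for a label `r_j` of the complementary internal degree. -/
def tensorLabel (k : K) (j : R.HomIndex (t - degM k) s) : R.Index degM t s :=
  ⟨toLex (k, j.1), add_eq_of_eq_sub' j.2⟩

theorem tensorLabel_injective (k : K) : Function.Injective (R.tensorLabel degM t s k) :=
  fun _ _ h => Subtype.ext (congrArg (fun p : R.Index degM t s => (ofLex p.1).2) h)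

theorem exists_eq_tensorLabel (p : R.Index degM t s) : ∃ k j, p = R.tensorLabel degM t s k j :=
  ⟨(ofLex p.1).1, ⟨(ofLex p.1).2, eq_sub_of_add_eq' p.2⟩, rfl⟩

theorem tag_mem_resolutionTags_iff {TF : ∀ n, Set (Item (Σ s, R.HomIndex n s))}
    {x y : Σ s, R.Index degM t s} :
    .tag x y ∈ R.resolutionTags degM TF t ↔ ∃ k a c, .tag a c ∈ TF (t - degM k) ∧
      x = ⟨a.1, R.tensorLabel degM t a.1 k a.2⟩ ∧ y = ⟨c.1, R.tensorLabel degM t c.1 k c.2⟩ := by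
  constructor
  · rintro ⟨k, n, h, a, c, hac, h_eq⟩
    obtain rfl : n = t - degM k := eq_sub_of_add_eq' h
    cases h_eq
    exact ⟨k, a, c, hac, rfl, rfl⟩
  · rintro ⟨k, a, c, hac, rfl, rfl⟩
    exact ⟨k, _, add_sub_cancel _ _, a, c, hac, rfl⟩

end Label

section Component

variable (h𝓜 : IsGradedModule 𝓜) (he : ∀ k, e k ∈ 𝓜 (degM k)) (k : K)

/-- The component `f ↦ φ (e*_k ⊗ f)` of a functional `φ` on `M ⊗ F_s`. It commutes with the
Steenrod operations because `φ` vanishes on `M^n ⊗ F_s` for `n` above the degree of `e_k`. -/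
noncomputable def component (φ : (R.ahComplex 𝓜 t).fil (degM k) s) : R.hom (t - degM k) s :=
  ⟨φ.1.1 ∘ₗ TensorProduct.mk (ZMod 2) M (R.F s) (e k), by
    refine ⟨fun i hi x => ?_, fun p hp x hx => φ.1.2.2 _ _ (by omega) _ (he k) _ hx⟩
    change φ.1.1 (e k ⊗ₜ (Sq i • x)) = 0
    have h_sum := φ.1.2.1 i hi (e k ⊗ₜ x)
    rw [sqTensor_tmul, map_sum, Finset.sum_eq_single (0, i)] at h_sum
    · rwa [Sq_zero, one_smul] at h_sum
    · rintro ⟨a, b⟩ hab h_ne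
      have h_pos : a ≠ 0 := by
        rintro rfl
        simp_all
      exact φ.2 _ (by omega) _ (h𝓜.sq_mem a _ _ (he k)) _
    · simp⟩

theorem component_d {φ : (R.ahComplex 𝓜 t).X s} (hφ : φ ∈ (R.ahComplex 𝓜 t).fil (degM k) s) :
    component h𝓜 he k ⟨_, (R.ahComplex 𝓜 t).d_mem _ s φ hφ⟩ =
      R.homD (t - degM k) s (component h𝓜 he k ⟨φ, hφ⟩) := rfl

variable [Finite K]

theorem homBasis_repr_component (φ : (R.ahComplex 𝓜 t).fil (degM k) s)
    (j : R.HomIndex (t - degM k) s) :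
    (R.homBasis _ s).repr (component h𝓜 he k φ) j =
      (R.cochainBasis e t s h𝓜 he).repr φ.1 (R.tensorLabel degM t s k j) := by
  rw [homBasis_repr]
  exact (R.cochainBasis_repr e t s h𝓜 he φ.1 (R.tensorLabel degM t s k j)).symm

theorem cochainBasis_repr_d {φ : (R.ahComplex 𝓜 t).X s}
    (hφ : φ ∈ (R.ahComplex 𝓜 t).fil (degM k) s) (j : R.HomIndex (t - degM k) (s + 1)) :
    (R.cochainBasis e t (s + 1) h𝓜 he).repr ((R.ahComplex 𝓜 t).d s φ)
      (R.tensorLabel degM t (s + 1) k j) =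
    (R.homBasis _ (s + 1)).repr (R.homD _ s (component h𝓜 he k ⟨φ, hφ⟩)) j := by
  rw [← component_d, homBasis_repr_component]

/-- The linear extension of `r_j ↦ e_k ⊗ r_j`. -/
noncomputable def tensorHom : R.hom (t - degM k) s →ₗ[ZMod 2] (R.ahComplex 𝓜 t).X s :=
  (R.cochainBasis e t s h𝓜 he).repr.symm.toLinearMap ∘ₗ
    Finsupp.lmapDomain (ZMod 2) (ZMod 2) (R.tensorLabel degM t s k) ∘ₗ
    (R.homBasis (t - degM k) s).repr.toLinearMap

variable (ψ : R.hom (t - degM k) s)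

theorem cochainBasis_repr_tensorHom_self (j : R.HomIndex (t - degM k) s) :
    (R.cochainBasis e t s h𝓜 he).repr (tensorHom h𝓜 he k ψ) (R.tensorLabel degM t s k j) =
      (R.homBasis _ s).repr ψ j := by
  simp only [tensorHom, LinearMap.comp_apply, LinearEquiv.coe_coe, LinearEquiv.apply_symm_apply]
  exact Finsupp.mapDomain_apply (tensorLabel_injective k) _ _

theorem cochainBasis_repr_tensorHom_of_ne {p : R.Index degM t s} (hp : (ofLex p.1).1 ≠ k) :
    (R.cochainBasis e t s h𝓜 he).repr (tensorHom h𝓜 he k ψ) p = 0 := by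
  simp only [tensorHom, LinearMap.comp_apply, LinearEquiv.coe_coe, LinearEquiv.apply_symm_apply]
  refine Finsupp.mapDomain_of_notMem_range _ _ ?_
  rintro ⟨j, rfl⟩
  exact hp rfl

theorem tensorHom_mem_fil : tensorHom h𝓜 he k ψ ∈ (R.ahComplex 𝓜 t).fil (degM k) s := by
  refine (R.mem_fil_iff e t s h𝓜 he _ _).2 fun p hp => ?_
  exact cochainBasis_repr_tensorHom_of_ne h𝓜 he k ψ fun hk => hp.ne (congrArg degM hk).symm

theorem cochainBasis_repr_d_tensorHom_self (j : R.HomIndex (t - degM k) (s + 1)) :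
    (R.cochainBasis e t (s + 1) h𝓜 he).repr ((R.ahComplex 𝓜 t).d s (tensorHom h𝓜 he k ψ))
      (R.tensorLabel degM t (s + 1) k j) = (R.homBasis _ (s + 1)).repr (R.homD _ s ψ) j := by
  rw [cochainBasis_repr_d h𝓜 he k (tensorHom_mem_fil h𝓜 he k ψ)]
  congr 3
  refine (R.homBasis _ s).ext_elem fun j => ?_
  rw [homBasis_repr_component, cochainBasis_repr_tensorHom_self]

theorem cochainBasis_repr_d_tensorHom_of_ne {p : R.Index degM t (s + 1)}
    (hp : (ofLex p.1).1 ≠ k) (hp' : degM k ≤ R.wt degM t (s + 1) p) :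
    (R.cochainBasis e t (s + 1) h𝓜 he).repr ((R.ahComplex 𝓜 t).d s (tensorHom h𝓜 he k ψ)) p =
      0 := by
  have h_fil := tensorHom_mem_fil h𝓜 he k ψ
  obtain ⟨l, j, rfl⟩ := exists_eq_tensorLabel p
  have h_fil' := (R.ahComplex 𝓜 t).fil_mono _ _ hp' s h_fil
  have h_ne : l ≠ k := hp
  have h_component : component h𝓜 he l ⟨_, h_fil'⟩ = 0 := by
    refine (R.homBasis _ s).ext_elem fun j => ?_
    rw [homBasis_repr_component, map_zero]
    exact cochainBasis_repr_tensorHom_of_ne h𝓜 he k ψ (p := R.tensorLabel degM t s l j) h_ne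
  rw [cochainBasis_repr_d h𝓜 he l h_fil', h_component]
  simp

end Component

section Tags

variable (h𝓜 : IsGradedModule 𝓜) (he : ∀ k, e k ∈ 𝓜 (degM k)) [LinearOrder K]

theorem isAdapted_cochainBasis [Finite K] (hmono : Monotone degM) :
    FilteredComplex.IsAdapted (fun s => R.cochainBasis e t s h𝓜 he) (R.wt degM t) where
  monotone _ _ _ hpq := hmono (Prod.Lex.monotone_fst _ _ hpq)
  mem_fil_iff n s φ := R.mem_fil_iff e t s h𝓜 he n φ

theorem tensorLabel_lt_tensorLabel {k : K} {i j : R.HomIndex (t - degM k) s} :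
    R.tensorLabel degM t s k i < R.tensorLabel degM t s k j ↔ i < j := by
  refine (Prod.Lex.toLex_lt_toLex (x := (k, i.1)) (y := (k, j.1))).trans ?_
  simp

theorem tensorLabel_le_tensorLabel {k : K} {i j : R.HomIndex (t - degM k) s} :
    R.tensorLabel degM t s k i ≤ R.tensorLabel degM t s k j ↔ i ≤ j :=
  le_iff_le_iff_lt_iff_lt.2 tensorLabel_lt_tensorLabel

variable [Finite K]

theorem isLeading_component {k : K} {φ : (R.ahComplex 𝓜 t).fil (degM k) s}
    {j : R.HomIndex (t - degM k) s}
    (h : IsLeading (R.cochainBasis e t s h𝓜 he) φ.1 (R.tensorLabel degM t s k j)) :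
    IsLeading (R.homBasis _ s) (component h𝓜 he k φ) j := by
  refine ⟨by simpa only [homBasis_repr_component] using h.1, fun j' hj' => ?_⟩
  rw [homBasis_repr_component]
  exact h.2 _ (tensorLabel_lt_tensorLabel.2 hj')

theorem isLeading_d_component {k : K} {φ : (R.ahComplex 𝓜 t).X s}
    (hφ : φ ∈ (R.ahComplex 𝓜 t).fil (degM k) s) {j : R.HomIndex (t - degM k) (s + 1)}
    (h : IsLeading (R.cochainBasis e t (s + 1) h𝓜 he) ((R.ahComplex 𝓜 t).d s φ)
      (R.tensorLabel degM t (s + 1) k j)) :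
    IsLeading (R.homBasis _ (s + 1)) (R.homD _ s (component h𝓜 he k ⟨φ, hφ⟩)) j :=
  isLeading_component h𝓜 he (φ := ⟨_, (R.ahComplex 𝓜 t).d_mem _ s φ hφ⟩) h

theorem isLeading_tensorHom {k : K} {ψ : R.hom (t - degM k) s} {j : R.HomIndex (t - degM k) s}
    (h : IsLeading (R.homBasis _ s) ψ j) :
    IsLeading (R.cochainBasis e t s h𝓜 he) (tensorHom h𝓜 he k ψ)
      (R.tensorLabel degM t s k j) := by
  refine ⟨by simpa only [cochainBasis_repr_tensorHom_self] using h.1, fun p hp => ?_⟩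
  by_cases hk : (ofLex p.1).1 = k
  · obtain ⟨l, i, rfl⟩ := exists_eq_tensorLabel p
    obtain rfl : l = k := hk
    rw [cochainBasis_repr_tensorHom_self]
    exact h.2 i (tensorLabel_lt_tensorLabel.1 hp)
  · exact cochainBasis_repr_tensorHom_of_ne h𝓜 he k ψ hk

theorem isLeading_d_tensorHom (hmono : Monotone degM) {k : K} {ψ : R.hom (t - degM k) s}
    {j : R.HomIndex (t - degM k) (s + 1)}
    (h : IsLeading (R.homBasis _ (s + 1)) (R.homD _ s ψ) j) :
    IsLeading (R.cochainBasis e t (s + 1) h𝓜 he)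
      ((R.ahComplex 𝓜 t).d s (tensorHom h𝓜 he k ψ)) (R.tensorLabel degM t (s + 1) k j) := by
  refine ⟨by simpa only [cochainBasis_repr_d_tensorHom_self] using h.1, fun p hp => ?_⟩
  by_cases hk : (ofLex p.1).1 = k
  · obtain ⟨l, i, rfl⟩ := exists_eq_tensorLabel p
    obtain rfl : l = k := hk
    rw [cochainBasis_repr_d_tensorHom_self]
    exact h.2 i (tensorLabel_lt_tensorLabel.1 hp)
  · exact cochainBasis_repr_d_tensorHom_of_ne h𝓜 he k ψ hk
      (hmono (Prod.Lex.monotone_fst _ _ hp.le))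

theorem tensorLabel_mem_lowerBounds_boundarySources (hmono : Monotone degM) {k : K}
    {a : R.HomIndex (t - degM k) (s + 1)} {c : R.HomIndex (t - degM k) s}
    (hc : c ∈ lowerBounds (boundarySources (X := fun s => R.hom (t - degM k) s) (R.homD _)
      (R.homBasis _) s a)) :
    R.tensorLabel degM t s k c ∈ lowerBounds (boundarySources (R.ahComplex 𝓜 t).d
      (fun s => R.cochainBasis e t s h𝓜 he) s (R.tensorLabel degM t (s + 1) k a)) := by
  rintro p ⟨y, hy, hdy⟩
  obtain ⟨l, c', rfl⟩ := exists_eq_tensorLabel p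
  rcases lt_or_ge k l with h_lt | h_ge
  · exact (Prod.Lex.toLex_lt_toLex.2 (.inl h_lt)).le
  have hb := R.isAdapted_cochainBasis (t := t) h𝓜 he hmono
  have h_fil : y ∈ (R.ahComplex 𝓜 t).fil (degM l) s := hb.mem_fil_of_isLeading hy
  have h_le : degM k ≤ degM l :=
    hb.wt_le_of_isLeading hdy ((R.ahComplex 𝓜 t).d_mem _ s y h_fil)
  have h_fil_k := (hmono h_ge).antisymm h_le ▸ h_fil
  have h_lead := isLeading_d_component h𝓜 he h_fil_k hdy
  rcases h_ge.eq_or_lt with rfl | h_lt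
  · have h_lead_y := isLeading_component h𝓜 he (φ := ⟨y, h_fil_k⟩) hy
    exact tensorLabel_le_tensorLabel.2 (hc ⟨_, h_lead_y, h_lead⟩)
  · have h_zero : component h𝓜 he k ⟨y, h_fil_k⟩ = 0 := by
      refine (R.homBasis _ s).ext_elem fun j => ?_
      rw [homBasis_repr_component, map_zero]
      exact hy.2 _ (Prod.Lex.toLex_lt_toLex.2 (.inl h_lt))
    exact absurd (by rw [h_zero, map_zero]) h_lead.ne_zero

theorem isLeast_boundarySources_tensorLabel (hmono : Monotone degM) {k : K}
    {a : R.HomIndex (t - degM k) (s + 1)} {c : R.HomIndex (t - degM k) s}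
    (hc : IsLeast (boundarySources (X := fun s => R.hom (t - degM k) s) (R.homD _)
      (R.homBasis _) s a) c) :
    IsLeast (boundarySources (R.ahComplex 𝓜 t).d (fun s => R.cochainBasis e t s h𝓜 he) s
      (R.tensorLabel degM t (s + 1) k a)) (R.tensorLabel degM t s k c) := by
  obtain ⟨ψ, hψ, hdψ⟩ := hc.1
  exact ⟨⟨_, isLeading_tensorHom h𝓜 he hψ, isLeading_d_tensorHom h𝓜 he hmono hdψ⟩,
    tensorLabel_mem_lowerBounds_boundarySources h𝓜 he hmono hc.2⟩

theorem isLeast_boundarySources_and_wt_eq_iff (hmono : Monotone degM) {k : K}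
    {a : R.HomIndex (t - degM k) (s + 1)} {p : R.Index degM t s} :
    IsLeast (boundarySources (R.ahComplex 𝓜 t).d (fun s => R.cochainBasis e t s h𝓜 he) s
        (R.tensorLabel degM t (s + 1) k a)) p ∧ R.wt degM t s p = degM k ↔
      ∃ c, IsLeast (boundarySources (X := fun s => R.hom (t - degM k) s) (R.homD _)
        (R.homBasis _) s a) c ∧ p = R.tensorLabel degM t s k c := by
  constructor
  · rintro ⟨hp, h_wt⟩
    obtain ⟨y, hy, hdy⟩ := hp.1
    have h_fil : y ∈ (R.ahComplex 𝓜 t).fil (degM k) s :=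
      h_wt ▸ (R.isAdapted_cochainBasis h𝓜 he hmono).mem_fil_of_isLeading hy
    have h_lead := isLeading_d_component h𝓜 he h_fil hdy
    obtain ⟨j, hj⟩ := exists_isLeading (R.homBasis _ s) (x := component h𝓜 he k ⟨y, h_fil⟩)
      fun h_zero => h_lead.ne_zero (by rw [h_zero, map_zero])
    obtain ⟨c, hc⟩ := exists_isLeast_boundarySources (X := fun s => R.hom (t - degM k) s)
      ⟨_, _, hj, h_lead⟩
    exact ⟨c, hc, hp.unique (isLeast_boundarySources_tensorLabel h𝓜 he hmono hc)⟩
  · rintro ⟨c, hc, rfl⟩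
    exact ⟨isLeast_boundarySources_tensorLabel h𝓜 he hmono hc, rfl⟩

theorem tag_mem_resolutionTags_iff_wt_eq (hmono : Monotone degM)
    {TF : ∀ n, Set (Item (Σ s, R.HomIndex n s))}
    (hTF : ∀ n, IsCurtisTable (R.homD n) (R.homBasis n) (TF n))
    {T : Set (Item (Σ s, R.Index degM t s))}
    (hT : IsCurtisTable (R.ahComplex 𝓜 t).d (fun s => R.cochainBasis e t s h𝓜 he) T)
    {x y : Σ s, R.Index degM t s} :
    .tag x y ∈ R.resolutionTags degM TF t ↔
      .tag x y ∈ T ∧ R.wt degM t x.1 x.2 = R.wt degM t y.1 y.2 := by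
  have hTF_iff {k : K} {s : ℕ} {a : R.HomIndex (t - degM k) (s + 1)} {c : R.HomIndex _ s} :=
    (hTF (t - degM k)).isCurtisMatching.iff_isLeast (X := fun s => R.hom (t - degM k) s)
      (R.homD_homD _) (a := a) (c := c)
  have hT_iff {s : ℕ} {a : R.Index degM t (s + 1)} {c : R.Index degM t s} :=
    hT.isCurtisMatching.iff_isLeast (R.ahComplex 𝓜 t).d_d (a := a) (c := c)
  rw [tag_mem_resolutionTags_iff]
  constructor
  · rintro ⟨k, ⟨s', a⟩, ⟨s, c⟩, hac, rfl, rfl⟩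
    obtain rfl : s' = s + 1 := (hTF _).degree _ _ hac
    obtain ⟨hc, h_wt⟩ :=
      (isLeast_boundarySources_and_wt_eq_iff h𝓜 he hmono).2 ⟨c, hTF_iff.1 hac, rfl⟩
    exact ⟨hT_iff.2 hc, h_wt.symm⟩
  · obtain ⟨⟨s', a⟩, ⟨s, p⟩⟩ := x, y
    rintro ⟨hap, h_wt⟩
    obtain rfl : s' = s + 1 := hT.degree _ _ hap
    obtain ⟨k, a, rfl⟩ := exists_eq_tensorLabel a
    obtain ⟨c, hc, rfl⟩ :=
      (isLeast_boundarySources_and_wt_eq_iff h𝓜 he hmono).1 ⟨hT_iff.1 hap, h_wt.symm⟩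
    exact ⟨k, ⟨s + 1, a⟩, ⟨s, c⟩, hTF_iff.2 hc, rfl, rfl⟩

theorem tags_zero_eq_resolutionTags (hmono : Monotone degM)
    {TF : ∀ n, Set (Item (Σ s, R.HomIndex n s))}
    (hTF : ∀ n, IsCurtisTable (R.homD n) (R.homBasis n) (TF n))
    {T : Set (Item (Σ s, R.Index degM t s))}
    (hT : IsCurtisTable (R.ahComplex 𝓜 t).d (fun s => R.cochainBasis e t s h𝓜 he) T)
    (P : (R.ahComplex 𝓜 t).LabelledPages (fun s => R.cochainBasis e t s h𝓜 he) (R.wt degM t)) :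
    P.tags 0 = R.resolutionTags degM TF t := by
  have h_tag (x y : Σ s, R.Index degM t s) :
      .tag x y ∈ P.tags 0 ↔ .tag x y ∈ R.resolutionTags degM TF t := by
    rw [tag_mem_resolutionTags_iff_wt_eq h𝓜 he hmono hTF hT,
      P.tag_mem_tags_iff (isAdapted_cochainBasis h𝓜 he hmono) hT, Nat.cast_zero, sub_zero]
  refine Set.Subset.antisymm (fun it h => ?_) ?_
  · obtain ⟨x, y, rfl⟩ := P.exists_eq_tag_of_mem_tags h
    exact (h_tag x y).1 h
  · rintro _ ⟨k, n, h, a, c, hac, rfl⟩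
    exact (h_tag _ _).2 ⟨k, n, h, a, c, hac, rfl⟩

end Tags

end FreeResolution

end CurtisAHSS

open CurtisAHSS in
theorem mainTheorem4
    {M : Type*} [AddCommGroup M] [Module (ZMod 2) M] [Module SteenrodAlgebra M]
    [IsScalarTower (ZMod 2) SteenrodAlgebra M]
    (𝓜 : ℤ → Submodule (ZMod 2) M) (h𝓜 : IsGradedModule 𝓜)
    {K : Type*} [Finite K] [LinearOrder K] (e : Module.Basis K (ZMod 2) M)
    (degM : K → ℤ) (he : ∀ k, e k ∈ 𝓜 (degM k)) (hmono : Monotone degM)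
    (R : FreeResolution) :
    ∃ (ρ : ∀ n s, Module.Basis (R.HomIndex n s) (ZMod 2) (R.hom n s))
      (β : ∀ t s, Module.Basis (R.Index degM t s) (ZMod 2) ((R.ahComplex 𝓜 t).X s)),
      R.IsDualHomBasis ρ ∧ R.IsDualBasis 𝓜 e degM β ∧
      (∀ n, ∃! T, IsCurtisTable (R.homD n) (ρ n) T) ∧
      (∀ t, ∃! T, IsCurtisTable (R.ahComplex 𝓜 t).d (β t) T) ∧
      (∀ t, Nonempty ((R.ahComplex 𝓜 t).LabelledPages (β t) (R.wt degM t))) ∧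
      ∀ (TF : ∀ n, Set (Item (Σ s, R.HomIndex n s)))
        (_ : ∀ n, IsCurtisTable (R.homD n) (ρ n) (TF n))
        (t : ℤ) (T : Set (Item (Σ s, R.Index degM t s)))
        (_ : IsCurtisTable (R.ahComplex 𝓜 t).d (β t) T)
        (P : (R.ahComplex 𝓜 t).LabelledPages (β t) (R.wt degM t)),
        -- the tags coming from the resolution; they are the tags of the page `E₀`
        (R.resolutionTags degM TF t ⊆ T ∧ P.tags 0 = R.resolutionTags degM TF t) ∧
        -- the other tags form the table of the differentials `d_r`, `r ≥ 1`
        ({it | it ∈ T ∧ (∃ a c, it = Item.tag a c) ∧ it ∉ R.resolutionTags degM TF t} =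
            {it | ∃ r : ℕ, 1 ≤ r ∧ it ∈ P.tags r} ∧
          ∀ (r : ℕ) (a c : Σ s, R.Index degM t s), Item.tag a c ∈ P.tags r →
            R.wt degM t a.1 a.2 = R.wt degM t c.1 c.2 - r) ∧
        -- the labels in none of these tags are the untagged items; they survive to all pages
        (∀ x : Σ s, R.Index degM t s,
          (Item.untagged x ∈ T ↔ ¬ ∃ it : Item (Σ s, R.Index degM t s), it.Contains x ∧
            (it ∈ R.resolutionTags degM TF t ∨ ∃ r : ℕ, 1 ≤ r ∧ it ∈ P.tags r)) ∧
          (Item.untagged x ∈ T ↔ ∀ r, x.2 ∈ P.U r x.1)) ∧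
        -- a cycle with untagged leading term `x` is a permanent cycle with the name `x` on
        -- all pages, and such cycles give a basis of `E_∞`
        ∀ (s : ℕ) (z : {x : R.Index degM t s // Item.untagged ⟨s, x⟩ ∈ T} →
            (R.ahComplex 𝓜 t).X s),
          (∀ x, (R.ahComplex 𝓜 t).d s (z x) = 0 ∧ IsLeading (β t s) (z x) x.1) →
          (∀ (x) (r : ℕ), ∃ (hx : x.1 ∈ P.U r s)
            (hz : z x ∈ (R.ahComplex 𝓜 t).Z r (R.wt degM t s x.1) s),
            IsLeading (P.β r s) ((R.ahComplex 𝓜 t).cls r (R.wt degM t s x.1) s ⟨z x, hz⟩)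
              ⟨x.1, hx⟩) ∧
          ∀ n : ℤ, ∃ B : Module.Basis
              {x : {x : R.Index degM t s // Item.untagged ⟨s, x⟩ ∈ T} //
                R.wt degM t s x.1 = n} (ZMod 2) ((R.ahComplex 𝓜 t).Einf n s),
            ∀ x, ∃ hz : z x.1 ∈ (R.ahComplex 𝓜 t).Zinf n s,
              B x = Submodule.Quotient.mk ⟨z x.1, hz⟩ := by
  have hb (t : ℤ) : (R.ahComplex 𝓜 t).IsAdapted (fun s => R.cochainBasis e t s h𝓜 he)
      (R.wt degM t) := FreeResolution.isAdapted_cochainBasis h𝓜 he hmono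
  refine ⟨R.homBasis, fun t s => R.cochainBasis e t s h𝓜 he, R.isDualHomBasis_homBasis,
    R.isDualBasis_cochainBasis e h𝓜 he,
    fun n => existsUnique_isCurtisTable (X := fun s => R.hom n s) (R.homBasis n) (R.homD_homD n),
    fun t => existsUnique_isCurtisTable _ (R.ahComplex 𝓜 t).d_d,
    fun t => (hb t).nonempty_labelledPages, fun TF hTF t T hT P => ?_⟩
  have h_tag {r : ℕ} {a c : Σ s, R.Index degM t s} :=
    P.tag_mem_tags_iff (hb t) hT (r := r) (a := a) (c := c)
  rw [← FreeResolution.tags_zero_eq_resolutionTags h𝓜 he hmono hTF hT P]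
  refine ⟨⟨fun it h => ?_, rfl⟩,
    ⟨P.setOf_tag_notMem_tags_zero (hb t) hT, fun r a c h => (h_tag.1 h).2⟩,
    fun x => ⟨P.untagged_mem_iff_not_exists_mem_tags (hb t) hT,
      P.untagged_mem_iff_forall_mem_U (hb t) hT⟩,
    fun s z hz => ⟨fun x r => ?_, (hb t).exists_basis_Einf hT hz⟩⟩
  · obtain ⟨a, c, rfl⟩ := P.exists_eq_tag_of_mem_tags h
    exact (h_tag.1 h).1
  · exact P.exists_isLeading_cls_of_untagged_mem (hb t) hT x.2 (hz x).1 (hz x).2 r
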